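/- Let $n\ge 1$. Signed graphs on $[n]=\{1,\dots,n\}$ are finite multigraphs whose edges $(i,j,\epsilon)=(j,i,\epsilon)$ carry a sign $\epsilon\in\{+,-\}$, all loops being positive. Put $v(i,j,-)=e_i-e_j$ and $v(i,j,+)=e_i+e_j$ for $i<j$, and $v(k,k,+)=2e_k$; these vectors form the set $\Phi^+$ of positive roots of type $C_n$. Let $$\mathcal P(C_n^+)=\mathrm{ConvHull}\bigl(\{0\}\cup\Phi^+\bigr)\subset\mathbb R^n ,$$ and for a signed graph $G$ let $\mathcal C(G)$ be the cone of all nonnegative linear combinations of the vectors $v(e)$, $e\in E(G)$, and $$\mathcal P(G)=\mathrm{ConvHull}\bigl(\{0\}\cup(\Phi^+\cap\mathcal C(G))\bigr).$$ A positive edge is incident to both its endpoints with sign $+$; a negative edge is incident to its smaller endpoint with sign $+$ and to its greater endpoint with sign $-$. The graph $G$ is alternating if at every vertex all edges incident to it are incident with the same sign. It is well-structured if (i) there are no $i<j<k<l$ with edges $(i,k,\epsilon_1)$ and $(j,l,\epsilon_2)$ in $G$; (ii) any two edges $(i,j,+),(k,l,+)$ with $i<j$, $k<l$ satisfy $i<l$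 and $k<j$; (iii) any loop $(i,i,+)$ and edge $(k,l,+)$ with $k<l$ satisfy $k\le i\le l$; (iv) there are no edges $(i,i,+),(k,j,-)$ with $k<i<j$; (v) there are no edges $(i,j,+),(k,l,-)$ with $k\le i<j\le l$; (vi) $G$ is connected, has exactly one loop, and contains no nonloop cycle (two parallel nonloop edges, of whatever signs, count as a cycle). Theorem. Let $T^l_1,\dots,T^l_m$ be all the alternating well-structured graphs on $[n]$ (there are finitely many). Then $\mathcal P(T^l_1),\dots,\mathcal P(T^l_m)$ are $n$-dimensional simplices, each having the origin as a vertex and its other vertices in $\Phi^+$, and they form a triangulation of $\mathcal P(C_n^+)$: their union is $\mathcal P(C_n^+)$, any two of them with different indices have disjoint interiors, and any two of them intersect in the common face that is the convex hull of their common vertices. Furthermore, $$\mathrm{vol}_n\,\mathcal P(C_n^+)=\binom{2n-1}{n}\frac{2}{n!}.$$ -/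

import Mathlib

open MeasureTheory

/-- A signed edge `(i, j, ε)` on the vertex set `[n]` (modelled by `Fin n`), normalised so that
`i ≤ j`, which encodes the convention `(i, j, ε) = (j, i, ε)`. The sign is a unit of `ℤ`;
loops are positive. -/
@[ext]
structure SignedEdge (n : ℕ) where
  fst : Fin n
  snd : Fin n
  sign : ℤˣ
  fst_le_snd : fst ≤ snd
  loop_pos : fst = snd → sign = 1

namespace SignedEdge

variable {n : ℕ}

/-- `e.IncidentWith v s`: the edge `e` is incident to the vertex `v` with sign `s`. A positive edge
is incident with sign `+` to both endpoints; a negative edge is incident with sign `+` to its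
smaller and with sign `-` to its greater endpoint. -/
def IncidentWith (e : SignedEdge n) (v : Fin n) (s : ℤˣ) : Prop :=
  (v = e.fst ∧ s = 1) ∨ (v = e.snd ∧ s = e.sign)

/-- The vector `e_i + ε e_j` of an edge `(i, j, ε)`, `i ≤ j`: it is `e_i - e_j` or `e_i + e_j` for
`i < j`, and `2 e_i` for a loop. -/
noncomputable def vec (e : SignedEdge n) : Fin n → ℝ :=
  Pi.single e.fst 1 + ((e.sign : ℤ) : ℝ) • Pi.single e.snd 1

end SignedEdge

/-- A signed graph on the vertex set `[n]`: a multigraph, given by its multiset of signed edges. -/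
@[ext]
structure SignedGraph (n : ℕ) where
  edges : Multiset (SignedEdge n)

/-- The set of positive roots of type `C_n`. -/
def positiveRoots (n : ℕ) : Set (Fin n → ℝ) :=
  {v | (∃ i j : Fin n, i < j ∧ v = Pi.single i 1 - Pi.single j 1) ∨
    (∃ i j : Fin n, i < j ∧ v = Pi.single i 1 + Pi.single j 1) ∨
    (∃ k : Fin n, v = (2 : ℝ) • Pi.single k 1)}

/-- The full root polytope of type `C_n`. -/
def fullRootPolytope (n : ℕ) : Set (Fin n → ℝ) :=
  convexHull ℝ (insert 0 (positiveRoots n))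

namespace SignedGraph

variable {n : ℕ}

/-- Every vertex is incident to its edges with one and the same sign. -/
def IsAlternating (G : SignedGraph n) : Prop :=
  ∀ v : Fin n, ∀ e ∈ G.edges, ∀ e' ∈ G.edges, ∀ s s' : ℤˣ,
    e.IncidentWith v s → e'.IncidentWith v s' → s = s'

/-- There are no vertices `i < j < k < l` such that `(i, k, ε₁)` and `(j, l, ε₂)` are edges. -/
def IsNoncrossing (G : SignedGraph n) : Prop :=
  ∀ e ∈ G.edges, ∀ e' ∈ G.edges,
    ¬ (e.fst < e'.fst ∧ e'.fst < e.snd ∧ e.snd < e'.snd)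

/-- The simple graph underlying `G`: signs, loops and multiplicities of edges are forgotten. -/
def toSimpleGraph (G : SignedGraph n) : SimpleGraph (Fin n) :=
  SimpleGraph.fromRel fun i j => ∃ e ∈ G.edges, e.fst = i ∧ e.snd = j

/-- The number of loops, counted with multiplicity. -/
def numLoops (G : SignedGraph n) : ℕ :=
  G.edges.countP fun e => e.fst = e.snd

/-- The multigraph `G` has no cycle other than loops: no cycle of length two, i.e. no two parallel
nonloop edges (of equal or different signs), and no cycle of length at least three. -/
def NoNonloopCycle (G : SignedGraph n) : Prop :=
  (∀ i j : Fin n, i < j → G.edges.countP (fun e => e.fst = i ∧ e.snd = j) ≤ 1) ∧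
    G.toSimpleGraph.IsAcyclic

/-- Well-structured signed graphs. -/
structure IsWellStructured (G : SignedGraph n) : Prop where
  noncrossing : G.IsNoncrossing
  /-- Nonloop positive edges `(i, j, +)`, `(k, l, +)` satisfy `i < l` and `k < j`. -/
  pos_pos : ∀ e ∈ G.edges, ∀ e' ∈ G.edges, e.sign = 1 → e'.sign = 1 → e.fst < e.snd →
    e'.fst < e'.snd → e.fst < e'.snd ∧ e'.fst < e.snd
  /-- A loop `(i, i, +)` and a nonloop positive edge `(k, l, +)` satisfy `k ≤ i ≤ l`. -/
  loop_pos : ∀ e ∈ G.edges, ∀ e' ∈ G.edges, e.fst = e.snd → e'.sign = 1 → e'.fst < e'.snd →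
    e'.fst ≤ e.fst ∧ e.fst ≤ e'.snd
  /-- No loop `(i, i, +)` and negative edge `(k, j, -)` with `k < i < j`. -/
  loop_neg : ∀ e ∈ G.edges, ∀ e' ∈ G.edges, e.fst = e.snd → e'.sign = -1 →
    ¬ (e'.fst < e.fst ∧ e.fst < e'.snd)
  /-- No positive edge `(i, j, +)` and negative edge `(k, l, -)` with `k ≤ i < j ≤ l`. -/
  pos_neg : ∀ e ∈ G.edges, ∀ e' ∈ G.edges, e.sign = 1 → e'.sign = -1 →
    ¬ (e'.fst ≤ e.fst ∧ e.fst < e.snd ∧ e.snd ≤ e'.snd)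
  connected : G.toSimpleGraph.Connected
  one_loop : G.numLoops = 1
  no_nonloop_cycle : G.NoNonloopCycle

/-- The cone generated by the vectors of the edges of `G`. -/
noncomputable def cone (G : SignedGraph n) : PointedCone ℝ (Fin n → ℝ) :=
  PointedCone.hull ℝ {v | ∃ e ∈ G.edges, v = e.vec}

/-- The transitive closure of `G`: all edges whose vector lies in the cone of `G`. -/
def transClosure (G : SignedGraph n) : Set (SignedEdge n) :=
  {e | e.vec ∈ G.cone}

/-- The root polytope of `G`: the convex hull of the origin and of the vectors of the edges in the
transitive closure of `G`. -/
def rootPolytope (G : SignedGraph n) : Set (Fin n → ℝ) :=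
  convexHull ℝ (insert 0 (SignedEdge.vec '' G.transClosure))

end SignedGraph

/-- `S` is the simplex with vertex set `V`. -/
def IsSimplexOn {n : ℕ} (V : Finset (Fin n → ℝ)) (S : Set (Fin n → ℝ)) : Prop :=
  AffineIndependent ℝ ((↑) : V → (Fin n → ℝ)) ∧ S = convexHull ℝ (V : Set (Fin n → ℝ))

/-- The sets `σ i` are `n`-dimensional simplices that form a triangulation of `P ⊆ ℝⁿ`, all having
the origin as a vertex and with all other vertices among the positive roots of type `C_n`. -/
structure IsCentralTriangulation {n : ℕ} {ι : Type*} (σ : ι → Set (Fin n → ℝ))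
    (P : Set (Fin n → ℝ)) : Prop where
  finite : Finite ι
  /-- Each member is an `n`-dimensional simplex (it has `n + 1` vertices), with the prescribed kind
  of vertices. -/
  isSimplex : ∀ i, ∃ V : Finset (Fin n → ℝ), V.card = n + 1 ∧ IsSimplexOn V (σ i) ∧
    0 ∈ V ∧ (V : Set (Fin n → ℝ)) ⊆ insert 0 (positiveRoots n)
  /-- Different members have disjoint interiors. -/
  disjoint_interior : ∀ i j, i ≠ j → Disjoint (interior (σ i)) (interior (σ j))
  /-- Any two members meet in a common face, the one spanned by their common vertices. -/
  inter_eq : ∀ i j, ∀ V W : Finset (Fin n → ℝ), IsSimplexOn V (σ i) → IsSimplexOn W (σ j) →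
    σ i ∩ σ j = convexHull ℝ ((V : Set (Fin n → ℝ)) ∩ W)
  /-- The members cover exactly `P`. -/
  iUnion_eq : ⋃ i, σ i = P

/-!
Call two signed edges compatible if they may occur together in an alternating well-structured graph
(`SignedEdge.Compat`), and let a representation of `x` be a nonnegative combination of edge vectors
with sum `x` whose edges in use are pairwise compatible (`IsRep`).

*Unique representations.* The positive roots of type `C_n` span the cone of all vectors with
nonnegative prefix sums, and every vector in this cone has exactly one representation
(`existsUnique_isRep`). It is found greedily, and each step is forced: the mass at the first negative
coordinate is matched with the last positive coordinate before it, as for parentheses; when no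
negative coordinate is left, the outermost remaining positive coordinates are matched with each
other, and what is left at the end goes into a loop. Alternation excludes cancellation, so the
coefficients add up to `‖x‖₁ / 2` (`IsRep.two_mul_sum`). Hence the root polytope consists of the
vectors of `ℓ¹`-norm at most `2` in the cone (`mem_fullRootPolytope_iff`).

*Triangulation.* Uniqueness makes compatible edge vectors linearly independent and shows that the
simplices of two alternating well-structured graphs meet in the face of their common edges. Such a
graph spans, being connected with a loop. Conversely, a compatible edge set that spans comes from
such a graph (`SignedEdge.IsCompatible.isWellStructured`): some functional with nonzero coordinates
vanishes on all nonloop edges (`SignedEdge.IsCompatible.exists_functional`), so every component needs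
a loop, and counting excludes cycles. The edges used by a generic vector span, which gives the
covering on a dense subset, hence everywhere.

*Volume.* Let `I n` be the integral of `exp (-‖x‖₁)` over the cone. Cutting a vector of `ℝⁿ` where
its prefix sums are minimal gives `∑ I k * I (n - k) = 2 ^ n` (`sum_coneMass_mul_coneMass`, the
argument of Sparre Andersen), so that `I n` is the central binomial coefficient divided by `2 ^ n`.
Integrating by layers, `I n` is also `n! / 2 ^ n` times the volume of the polytope
(`coneMass_eq_mul_volume`).
-/

/-! ### Signed edges, compatibility and representations -/

namespace SignedEdge

variable {n : ℕ}

instance : Finite (SignedEdge n) :=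
  Finite.of_injective (fun e : SignedEdge n => (e.fst, e.snd, e.sign)) fun e f h => by
    simp only [Prod.mk.injEq] at h
    exact SignedEdge.ext h.1 h.2.1 h.2.2

noncomputable instance : Fintype (SignedEdge n) := Fintype.ofFinite _

noncomputable instance : DecidableEq (SignedEdge n) := Classical.decEq _

/-- The positive edge `(i, j, +)`, a loop if `i = j`. -/
def pos (i j : Fin n) (h : i ≤ j) : SignedEdge n := ⟨i, j, 1, h, fun _ => rfl⟩

/-- The negative edge `(i, j, -)`. -/
def neg (i j : Fin n) (h : i < j) : SignedEdge n := ⟨i, j, -1, h.le, fun h' => absurd h' h.ne⟩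

lemma sign_cases (e : SignedEdge n) : e.sign = 1 ∨ e.sign = -1 := Int.units_eq_one_or _

lemma fst_lt_snd_of_neg {e : SignedEdge n} (h : e.sign = -1) : e.fst < e.snd := by
  refine lt_of_le_of_ne e.fst_le_snd fun h' => ?_
  have := e.loop_pos h'
  rw [h] at this
  exact absurd this (by decide)

lemma vec_apply (e : SignedEdge n) (v : Fin n) :
    e.vec v = (if v = e.fst then 1 else 0) + ((e.sign : ℤ) : ℝ) * (if v = e.snd then 1 else 0) := by
  simp [vec, Pi.single_apply]

lemma sum_mul_vec (e : SignedEdge n) (y : Fin n → ℝ) :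
    ∑ v, y v * e.vec v = y e.fst + ((e.sign : ℤ) : ℝ) * y e.snd := by
  simp only [vec_apply, mul_add, Finset.sum_add_distrib]
  congr 1
  · simp
  · simp [mul_comm]

lemma incidentWith_fst (e : SignedEdge n) : e.IncidentWith e.fst 1 := Or.inl ⟨rfl, rfl⟩

lemma incidentWith_snd (e : SignedEdge n) : e.IncidentWith e.snd e.sign := Or.inr ⟨rfl, rfl⟩

/-- The part of the conditions "alternating and well-structured" that concerns two edges at a time;
the last condition says that there is at most one loop. Only the consequences of alternation for
the ordered pair `(e, f)` are listed: those for `(f, e)` are part of `Compat f e`. -/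
structure Compat (e f : SignedEdge n) : Prop where
  fst_snd : e.fst = f.snd → f.sign = 1
  snd_snd : e.snd = f.snd → e.sign = f.sign
  noncrossing : ¬ (e.fst < f.fst ∧ f.fst < e.snd ∧ e.snd < f.snd)
  pos_pos : e.sign = 1 → f.sign = 1 → e.fst < e.snd → f.fst < f.snd →
    e.fst < f.snd ∧ f.fst < e.snd
  loop_pos : e.fst = e.snd → f.sign = 1 → f.fst < f.snd → f.fst ≤ e.fst ∧ e.fst ≤ f.snd
  loop_neg : e.fst = e.snd → f.sign = -1 → ¬ (f.fst < e.fst ∧ e.fst < f.snd)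
  pos_neg : e.sign = 1 → f.sign = -1 → ¬ (f.fst ≤ e.fst ∧ e.fst < e.snd ∧ e.snd ≤ f.snd)
  loop_loop : e.fst = e.snd → f.fst = f.snd → e.fst = f.fst

lemma compat_self (e : SignedEdge n) : e.Compat e where
  fst_snd := e.loop_pos
  snd_snd _ := rfl
  noncrossing h := lt_irrefl _ h.1
  pos_pos _ _ h _ := ⟨h, h⟩
  loop_pos h _ h' := absurd h h'.ne
  loop_neg h h' _ := absurd h (fst_lt_snd_of_neg h').ne
  pos_neg h h' := by rw [h] at h'; exact absurd h' (by decide)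
  loop_loop _ _ := rfl

/-- A set of edges any two of which may occur together in an alternating well-structured graph. -/
def IsCompatible (S : Set (SignedEdge n)) : Prop := ∀ e ∈ S, ∀ f ∈ S, e.Compat f

lemma IsCompatible.mono {S T : Set (SignedEdge n)} (hT : IsCompatible T) (h : S ⊆ T) :
    IsCompatible S := fun e he f hf => hT e (h he) f (h hf)

/-- Compatible edges meeting at a vertex are incident to it with the same sign. -/
lemma IsCompatible.sign_eq {S : Set (SignedEdge n)} (hS : IsCompatible S) {e f : SignedEdge n}
    (he : e ∈ S) (hf : f ∈ S) {v : Fin n} {s t : ℤˣ} (hs : e.IncidentWith v s)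
    (ht : f.IncidentWith v t) : s = t := by
  rcases hs with ⟨h1, rfl⟩ | ⟨h1, rfl⟩ <;> rcases ht with ⟨h2, rfl⟩ | ⟨h2, rfl⟩
  · rfl
  · exact ((hS e he f hf).fst_snd (h1.symm.trans h2)).symm
  · exact (hS f hf e he).fst_snd (h2.symm.trans h1)
  · exact (hS e he f hf).snd_snd (h1.symm.trans h2)

lemma mul_vec_nonneg {e : SignedEdge n} {v : Fin n} {s : ℤˣ}
    (h : ∀ t, e.IncidentWith v t → t = s) : 0 ≤ ((s : ℤ) : ℝ) * e.vec v := by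
  have hsq : ((s : ℤ) : ℝ) * ((s : ℤ) : ℝ) = 1 := by
    rcases Int.units_eq_one_or s with rfl | rfl <;> simp
  rw [vec_apply]
  by_cases h1 : v = e.fst <;> by_cases h2 : v = e.snd
  · have a := h _ (Or.inl ⟨h1, rfl⟩)
    have b := h _ (Or.inr ⟨h2, rfl⟩)
    rw [b, ← a, if_pos h1, if_pos h2]
    norm_num
  · have a := h _ (Or.inl ⟨h1, rfl⟩)
    rw [← a, if_pos h1, if_neg h2]
    norm_num
  · have b := h _ (Or.inr ⟨h2, rfl⟩)
    rw [b, if_neg h1, if_pos h2]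
    nlinarith
  · rw [if_neg h1, if_neg h2]
    norm_num

lemma one_le_mul_vec {e : SignedEdge n} {v : Fin n} {s : ℤˣ} (h : e.IncidentWith v s)
    (h' : ∀ t, e.IncidentWith v t → t = s) : 1 ≤ ((s : ℤ) : ℝ) * e.vec v := by
  have hsq : ((s : ℤ) : ℝ) * ((s : ℤ) : ℝ) = 1 := by
    rcases Int.units_eq_one_or s with rfl | rfl <;> simp
  rw [vec_apply]
  by_cases h1 : v = e.fst <;> by_cases h2 : v = e.snd
  · have a := h' _ (Or.inl ⟨h1, rfl⟩)
    have b := h' _ (Or.inr ⟨h2, rfl⟩)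
    rw [b, ← a, if_pos h1, if_pos h2]
    norm_num
  · have a := h' _ (Or.inl ⟨h1, rfl⟩)
    rw [← a, if_pos h1, if_neg h2]
    norm_num
  · have b := h' _ (Or.inr ⟨h2, rfl⟩)
    rw [b, if_neg h1, if_pos h2]
    nlinarith
  · rcases h with h | h
    · exact absurd h.1 h1
    · exact absurd h.1 h2

end SignedEdge

open SignedEdge

section Representations

variable {n : ℕ}

/-- The sum of the first `k` coordinates of `x`. -/
noncomputable def prefixSum (x : Fin n → ℝ) (k : ℕ) : ℝ :=
  ∑ i ∈ Finset.univ.filter (fun i : Fin n => (i : ℕ) < k), x i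

/-- The cone of all vectors with nonnegative prefix sums; it is the cone spanned by the positive
roots of type `C_n`. -/
def prefixCone (n : ℕ) : Set (Fin n → ℝ) := {x | ∀ k, 0 ≤ prefixSum x k}

lemma prefixSum_eq (x : Fin n → ℝ) (k : ℕ) :
    prefixSum x k = ∑ i : Fin n, (if (i : ℕ) < k then 1 else 0) * x i := by
  simp [prefixSum, Finset.sum_filter]

lemma prefixSum_vec (e : SignedEdge n) (k : ℕ) :
    prefixSum e.vec k = (if (e.fst : ℕ) < k then 1 else 0) +
      ((e.sign : ℤ) : ℝ) * (if (e.snd : ℕ) < k then 1 else 0) := by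
  rw [prefixSum_eq, sum_mul_vec e (fun i => if (i : ℕ) < k then 1 else 0)]

lemma vec_mem_prefixCone (e : SignedEdge n) : e.vec ∈ prefixCone n := by
  intro k
  rw [prefixSum_vec]
  have := e.fst_le_snd
  rw [Fin.le_def] at this
  rcases e.sign_cases with h | h <;> rw [h] <;> split_ifs <;> first | omega | norm_num

lemma prefixSum_add (x y : Fin n → ℝ) (k : ℕ) :
    prefixSum (x + y) k = prefixSum x k + prefixSum y k := by
  simp [prefixSum, Finset.sum_add_distrib]

lemma prefixSum_smul (a : ℝ) (x : Fin n → ℝ) (k : ℕ) :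
    prefixSum (a • x) k = a * prefixSum x k := by
  simp [prefixSum, Finset.mul_sum]

/-- `IsRep x c`: the nonnegative combination `∑ c e • e.vec` represents `x`, and the edges with
nonzero coefficient are pairwise compatible. -/
structure IsRep (x : Fin n → ℝ) (c : SignedEdge n → ℝ) : Prop where
  nonneg : ∀ e, 0 ≤ c e
  compat : IsCompatible {e | c e ≠ 0}
  sum_eq : ∑ e, c e • e.vec = x

namespace IsRep

variable {x : Fin n → ℝ} {c : SignedEdge n → ℝ}

lemma apply_eq (h : IsRep x c) (v : Fin n) : x v = ∑ e, c e * e.vec v := by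
  rw [← h.sum_eq]
  simp [Finset.sum_apply]

lemma coeff_mul_le (h : IsRep x c) {e : SignedEdge n} {v : Fin n} {s : ℤˣ} (he : c e ≠ 0)
    (hs : e.IncidentWith v s) : c e * (((s : ℤ) : ℝ) * e.vec v) ≤ ((s : ℤ) : ℝ) * x v := by
  rw [h.apply_eq, Finset.mul_sum]
  have key : ∀ f ∈ Finset.univ, 0 ≤ ((s : ℤ) : ℝ) * (c f * f.vec v) := by
    intro f _
    by_cases hf : c f = 0
    · simp [hf]
    · have := mul_vec_nonneg (e := f) (v := v) (s := s)
        (fun t ht => h.compat.sign_eq hf he ht hs)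
      have := mul_nonneg (h.nonneg f) this
      linarith
  have := Finset.single_le_sum key (Finset.mem_univ e)
  linarith

lemma coeff_le (h : IsRep x c) {e : SignedEdge n} {v : Fin n} {s : ℤˣ} (he : c e ≠ 0)
    (hs : e.IncidentWith v s) : c e ≤ ((s : ℤ) : ℝ) * x v := by
  have h1 := h.coeff_mul_le he hs
  have h2 := one_le_mul_vec hs (fun t ht => h.compat.sign_eq he he ht hs)
  nlinarith [h.nonneg e]

/-- There is no cancellation: a coordinate of `x` carries the sign with which the edges in use meet
the corresponding vertex. -/
lemma sign_mul_pos (h : IsRep x c) {e : SignedEdge n} {v : Fin n} {s : ℤˣ} (he : c e ≠ 0)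
    (hs : e.IncidentWith v s) : 0 < ((s : ℤ) : ℝ) * x v :=
  lt_of_lt_of_le (lt_of_le_of_ne (h.nonneg e) he.symm) (h.coeff_le he hs)

lemma fst_pos (h : IsRep x c) {e : SignedEdge n} (he : c e ≠ 0) : 0 < x e.fst := by
  simpa using h.sign_mul_pos he e.incidentWith_fst

lemma snd_pos (h : IsRep x c) {e : SignedEdge n} (he : c e ≠ 0) (hs : e.sign = 1) :
    0 < x e.snd := by
  simpa [hs] using h.sign_mul_pos he e.incidentWith_snd

lemma snd_neg (h : IsRep x c) {e : SignedEdge n} (he : c e ≠ 0) (hs : e.sign = -1) :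
    x e.snd < 0 := by
  simpa [hs] using h.sign_mul_pos he e.incidentWith_snd

/-- Without cancellation `‖x‖₁` is the sum of the `ℓ¹`-norms of the terms, and edge vectors have
`ℓ¹`-norm `2`. -/
lemma two_mul_sum (h : IsRep x c) : 2 * ∑ e, c e = ∑ v, |x v| := by
  have h1 : ∀ v, |x v| = ∑ e, c e * (SignType.sign (x v) * e.vec v) := by
    intro v
    have := h.apply_eq v
    calc |x v| = SignType.sign (x v) * x v := (sign_mul_self (x v)).symm
      _ = SignType.sign (x v) * ∑ e, c e * e.vec v := by rw [← this]
      _ = _ := by rw [Finset.mul_sum]; exact Finset.sum_congr rfl fun e _ => by ring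
  simp only [h1]
  rw [Finset.sum_comm, Finset.mul_sum]
  refine Finset.sum_congr rfl fun e _ => ?_
  rw [← Finset.mul_sum, sum_mul_vec e (fun v => ((SignType.sign (x v) : SignType) : ℝ))]
  by_cases he : c e = 0
  · simp [he]
  · rw [sign_pos (h.fst_pos he)]
    rcases e.sign_cases with hs | hs
    · rw [sign_pos (h.snd_pos he hs), hs]; norm_num; ring
    · rw [sign_neg (h.snd_neg he hs), hs]; norm_num; ring

/-- If all edges in use at the vertex `v` coincide with `e`, then `e` carries the whole
coordinate. -/
lemma apply_eq_of_forall (h : IsRep x c) {e : SignedEdge n} {v : Fin n}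
    (hv : ∀ f, c f ≠ 0 → (v = f.fst ∨ v = f.snd) → f = e) : x v = c e * e.vec v := by
  rw [h.apply_eq]
  refine Finset.sum_eq_single e (fun f _ hfe => ?_) (by simp)
  by_cases hf : c f = 0
  · simp [hf]
  · have : ¬ (v = f.fst ∨ v = f.snd) := fun h' => hfe (hv f hf h')
    push Not at this
    simp [vec_apply, this.1, this.2]

end IsRep

end Representations

/-! ### Existence and uniqueness of representations -/

section Existence

variable {n : ℕ}

lemma IsRep.add_single {x : Fin n → ℝ} {c : SignedEdge n → ℝ} (h : IsRep x c) {e : SignedEdge n}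
    {m : ℝ} (hm : 0 ≤ m) (he : ∀ f, c f ≠ 0 → e.Compat f ∧ f.Compat e) :
    IsRep (x + m • e.vec) (c + Pi.single e m) where
  nonneg f := by
    rw [Pi.add_apply]
    refine add_nonneg (h.nonneg f) ?_
    by_cases hf : f = e
    · subst hf; simpa using hm
    · simp [hf]
  compat f hf g hg := by
    have key : ∀ f, (c + Pi.single e m : SignedEdge n → ℝ) f ≠ 0 → f = e ∨ c f ≠ 0 := by
      intro f hf
      by_cases hfe : f = e
      · exact Or.inl hfe
      · right; simpa [hfe] using hf
    rcases key f hf with rfl | hf' <;> rcases key g hg with rfl | hg'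
    · exact compat_self _
    · exact (he g hg').1
    · exact (he f hf').2
    · exact h.compat f hf' g hg'
  sum_eq := by
    simp only [Pi.add_apply, add_smul, Finset.sum_add_distrib, h.sum_eq]
    congr 1
    rw [Finset.sum_eq_single e (fun f _ hf => by simp [hf]) (by simp)]
    simp

/-- `Peels x e m`: the coefficient of the edge `e` is `m` in every representation of `x`, and the
representations of `x` arise from those of `x - m • e.vec`, a vector with fewer nonzero
coordinates. -/
structure Peels (x : Fin n → ℝ) (e : SignedEdge n) (m : ℝ) : Prop where
  mem : x - m • e.vec ∈ prefixCone n
  card_lt : (Finset.univ.filter fun v => (x - m • e.vec) v ≠ 0).card <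
    (Finset.univ.filter fun v => x v ≠ 0).card
  coeff_eq : ∀ c, IsRep x c → c e = m
  isRep_add : ∀ c, IsRep (x - m • e.vec) c → IsRep x (c + Pi.single e m)

/-- A nonloop edge peels off as soon as any representation has to exhaust one of its two ends and
it is compatible with every edge that may be used once one of its ends is exhausted. -/
lemma peels_of_lt {x : Fin n → ℝ} {e : SignedEdge n} (hlt : e.fst < e.snd)
    (hi : 0 < x e.fst) (hj : 0 < ((e.sign : ℤ) : ℝ) * x e.snd)
    (hmem : ∀ m, 0 ≤ m → m ≤ x e.fst → m ≤ ((e.sign : ℤ) : ℝ) * x e.snd →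
      x - m • e.vec ∈ prefixCone n)
    (hforced : ∀ c, IsRep x c →
      (∀ f, c f ≠ 0 → (e.fst = f.fst ∨ e.fst = f.snd) → f = e) ∨
      (∀ f, c f ≠ 0 → (e.snd = f.fst ∨ e.snd = f.snd) → f = e))
    (hcompat : ∀ f : SignedEdge n, 0 < x f.fst → 0 < ((f.sign : ℤ) : ℝ) * x f.snd →
      (e.fst ≠ f.fst ∧ e.fst ≠ f.snd) ∨ (e.snd ≠ f.fst ∧ e.snd ≠ f.snd) →
      e.Compat f ∧ f.Compat e) :
    ∃ e m, Peels x e m := by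
  have hsq : ((e.sign : ℤ) : ℝ) * ((e.sign : ℤ) : ℝ) = 1 := by
    rcases e.sign_cases with h | h <;> simp [h]
  have hvi : e.vec e.fst = 1 := by simp [vec_apply, hlt.ne]
  have hvj : e.vec e.snd = ((e.sign : ℤ) : ℝ) := by simp [vec_apply, hlt.ne']
  obtain ⟨m, hm⟩ : ∃ m, m = min (x e.fst) (((e.sign : ℤ) : ℝ) * x e.snd) := ⟨_, rfl⟩
  have hm0 : 0 < m := by rw [hm]; exact lt_min hi hj
  have hmi : m ≤ x e.fst := by rw [hm]; exact min_le_left _ _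
  have hmj : m ≤ ((e.sign : ℤ) : ℝ) * x e.snd := by rw [hm]; exact min_le_right _ _
  have hxi : (x - m • e.vec) e.fst = x e.fst - m := by simp [hvi]
  have hxj : (x - m • e.vec) e.snd = x e.snd - m * ((e.sign : ℤ) : ℝ) := by simp [hvj]
  have hxj' : ((e.sign : ℤ) : ℝ) * (x - m • e.vec) e.snd = ((e.sign : ℤ) : ℝ) * x e.snd - m := by
    rw [hxj, mul_sub, mul_left_comm, hsq, mul_one]
  have hxv : ∀ v, v ≠ e.fst → v ≠ e.snd → (x - m • e.vec) v = x v := by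
    intro v h1 h2; simp [vec_apply, h1, h2]
  have hzero : (x - m • e.vec) e.fst = 0 ∨ (x - m • e.vec) e.snd = 0 := by
    rcases min_choice (x e.fst) (((e.sign : ℤ) : ℝ) * x e.snd) with h | h
    · left; rw [hxi, hm, h, sub_self]
    · right; rw [hxj, hm, h, mul_right_comm, hsq, one_mul, sub_self]
  have hxj0 : x e.snd ≠ 0 := by rintro h; rw [h, mul_zero] at hj; exact lt_irrefl _ hj
  -- Subtracting `m • e.vec` never creates a coordinate of a new sign.
  have hsign : ∀ v (s : ℤˣ), 0 < ((s : ℤ) : ℝ) * (x - m • e.vec) v → 0 < ((s : ℤ) : ℝ) * x v := by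
    intro v s h
    by_cases h1 : v = e.fst
    · subst h1
      rw [hxi] at h
      rcases Int.units_eq_one_or s with rfl | rfl
      · simpa using hi
      · simp at h; linarith
    by_cases h2 : v = e.snd
    · subst h2
      rcases eq_or_ne s e.sign with rfl | hs
      · exact hj
      · have : ((s : ℤ) : ℝ) = - ((e.sign : ℤ) : ℝ) := by
          rcases Int.units_eq_one_or s with rfl | rfl <;> rcases e.sign_cases with h' | h' <;>
            simp_all
        rw [this] at h
        linarith
    rwa [hxv v h1 h2] at h
  refine ⟨e, m, hmem m hm0.le hmi hmj, ?_, ?_, ?_⟩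
  · have hsub : ∀ v, (x - m • e.vec) v ≠ 0 → x v ≠ 0 := by
      intro v h
      by_cases h1 : v = e.fst
      · rw [h1]; exact hi.ne'
      by_cases h2 : v = e.snd
      · rw [h2]; exact hxj0
      rwa [hxv v h1 h2] at h
    refine Finset.card_lt_card (Finset.ssubset_iff_subset_ne.2 ⟨fun v hv => ?_, fun heq => ?_⟩)
    · rw [Finset.mem_filter] at hv ⊢
      exact ⟨hv.1, hsub v hv.2⟩
    · have hi' : e.fst ∈ Finset.univ.filter fun v => x v ≠ 0 := by simp [hi.ne']
      have hj' : e.snd ∈ Finset.univ.filter fun v => x v ≠ 0 := by simp [hxj0]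
      rw [← heq, Finset.mem_filter] at hi' hj'
      exact hzero.elim hi'.2 hj'.2
  · intro c hc
    have hce : c e ≠ 0 := by
      intro h0
      rcases hforced c hc with h | h
      · have := hc.apply_eq_of_forall h
        rw [h0, zero_mul] at this; exact hi.ne' this
      · have := hc.apply_eq_of_forall h
        rw [h0, zero_mul] at this; exact hxj0 this
    have h1 : c e ≤ x e.fst := by simpa using hc.coeff_le hce e.incidentWith_fst
    have h2 := hc.coeff_le hce e.incidentWith_snd
    refine le_antisymm (hm ▸ le_min h1 h2) ?_
    rcases hforced c hc with h | h
    · have := hc.apply_eq_of_forall h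
      rw [hvi, mul_one] at this; rwa [← this]
    · have := hc.apply_eq_of_forall h
      rw [hvj] at this
      rwa [this, mul_left_comm, hsq, mul_one] at hmj
  · intro c hc
    have := hc.add_single (e := e) hm0.le fun f hf => by
      refine hcompat f ?_ ?_ ?_
      · simpa using hsign f.fst 1 (by simpa using hc.sign_mul_pos hf f.incidentWith_fst)
      · exact hsign _ _ (hc.sign_mul_pos hf f.incidentWith_snd)
      · have hf1 := (hc.fst_pos hf).ne'
        have hf2 : (x - m • e.vec) f.snd ≠ 0 := fun h0 => by
          have := hc.sign_mul_pos hf f.incidentWith_snd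
          rw [h0, mul_zero] at this
          exact lt_irrefl _ this
        rcases hzero with h | h
        · left
          exact ⟨fun h' => hf1 (h' ▸ h), fun h' => hf2 (h' ▸ h)⟩
        · right
          exact ⟨fun h' => hf1 (h' ▸ h), fun h' => hf2 (h' ▸ h)⟩
    simpa using this

/-- The mass at the first negative coordinate is matched with the last positive coordinate before
it, as with parentheses. -/
lemma exists_peels_of_neg {x : Fin n → ℝ} (hx : x ∈ prefixCone n) (hneg : ∃ v, x v < 0) :
    ∃ e m, Peels x e m := by
  obtain ⟨j, hj, hjmin⟩ : ∃ j, x j < 0 ∧ ∀ v, x v < 0 → j ≤ v := by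
    obtain ⟨v, hv⟩ := hneg
    obtain ⟨j, hj, h⟩ := Finset.exists_min_image (Finset.univ.filter fun v => x v < 0) id
      ⟨v, by simpa using hv⟩
    exact ⟨j, by simpa using hj, fun v hv => h v (by simpa using hv)⟩
  have hnn : ∀ v, v < j → 0 ≤ x v := fun v hv => by
    by_contra h
    exact absurd (hjmin v (not_le.1 h)) (not_le.2 hv)
  have hex : ∃ i, 0 < x i ∧ i < j := by
    by_contra! hno
    have hsum := hx ((j : ℕ) + 1)
    refine absurd hsum (not_le.2 ?_)
    refine Finset.sum_neg' (fun v hv => ?_) ⟨j, by simp, hj⟩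
    rw [Finset.mem_filter] at hv
    rcases (Nat.lt_succ_iff.1 hv.2).lt_or_eq with h | h
    · by_contra h'
      exact absurd (hno v (not_le.1 h')) (not_le.2 h)
    · rw [Fin.ext h]; exact hj.le
  obtain ⟨i, hi, hij, himax⟩ : ∃ i, 0 < x i ∧ i < j ∧ ∀ v, 0 < x v → v < j → v ≤ i := by
    obtain ⟨v, hv⟩ := hex
    obtain ⟨i, hi, h⟩ := Finset.exists_max_image (Finset.univ.filter fun v => 0 < x v ∧ v < j) id
      ⟨v, by simpa using hv⟩
    rw [Finset.mem_filter] at hi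
    exact ⟨i, hi.2.1, hi.2.2, fun v hv hv' => h v (by simp [hv, hv'])⟩
  have hone : (1 : ℤˣ) ≠ -1 := by decide
  refine peels_of_lt (x := x) (e := neg i j hij) hij hi (by simpa [neg] using hj) ?_ ?_ ?_
  · intro m hm0 hmi _ k
    change m ≤ x i at hmi
    rw [sub_eq_add_neg, ← neg_smul, prefixSum_add, prefixSum_smul, prefixSum_vec]
    have hk := hx k
    have hij' : (i : ℕ) < j := hij
    simp only [neg]
    by_cases h1 : (i : ℕ) < k <;> by_cases h2 : (j : ℕ) < k
    · simp [h1, h2]; linarith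
    · have : x i ≤ prefixSum x k := by
        refine Finset.single_le_sum (f := x) (fun v hv => hnn v ?_) (by simpa using h1)
        rw [Finset.mem_filter] at hv
        rw [Fin.lt_def]; omega
      simp [h1, h2]; linarith
    · omega
    · simp [h1, h2]; linarith
  · intro c hc
    simp only [neg]
    by_contra! hno
    obtain ⟨⟨f, hf, hfi, hfe⟩, ⟨g, hg, hgj, hge⟩⟩ := hno
    have hg2 : j = g.snd := by
      rcases hgj with h | h
      · have := hc.fst_pos hg; rw [← h] at this; linarith
      · exact h
    have hgs : g.sign = -1 := by
      rcases g.sign_cases with h | h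
      · have := hc.snd_pos hg h; rw [← hg2] at this; linarith
      · exact h
    have hgj' : g.fst < j := hg2 ▸ fst_lt_snd_of_neg hgs
    have hgi : g.fst < i := by
      refine lt_of_le_of_ne (himax _ (hc.fst_pos hg) hgj') fun h => hge ?_
      exact SignedEdge.ext h hg2.symm hgs
    have c1 := hc.compat f hf g hg
    have c2 := hc.compat g hg f hf
    have p1 := hc.fst_pos hf
    have hle := f.fst_le_snd
    rcases f.sign_cases with hs | hs
    · have p2 := hc.snd_pos hf hs
      have hj1 : f.fst ≠ j := by rintro h; rw [h] at p1; linarith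
      have hj2 : f.snd ≠ j := by rintro h; rw [h] at p2; linarith
      have a1 := c1.pos_neg hs hgs
      have a2 := c1.noncrossing
      have a3 := c2.noncrossing
      have a4 := fun h => c1.loop_neg h hgs
      rcases lt_or_ge f.snd j with hlt | hge'
      · have := himax _ p2 hlt
        grind
      · grind
    · have p2 := hc.snd_neg hf hs
      have hj1 : f.snd ≠ i := by rintro h; rw [h] at p2; linarith
      have hjf := hjmin _ p2
      have hfi' : f.fst = i := by grind
      have a3 := c2.noncrossing
      have : f.snd ≠ j := fun h => hfe (SignedEdge.ext hfi' h hs)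
      grind
  · intro f hf1 hf2 hav
    have hle := f.fst_le_snd
    have hloop := f.loop_pos
    simp only [neg] at hav
    have hfj : f.fst ≠ j := by rintro h; rw [h] at hf1; linarith
    have b1 : f.fst < j → f.fst ≤ i := himax _ hf1
    rcases f.sign_cases with hs | hs
    · rw [hs] at hf2
      have hf2' : 0 < x f.snd := by simpa using hf2
      have hj2 : f.snd ≠ j := by rintro h; rw [h] at hf2'; linarith
      have b2 : f.snd < j → f.snd ≤ i := himax _ hf2'
      constructor <;> constructor <;> simp only [neg, hs] <;> grind
    · rw [hs] at hf2
      have hf2' : x f.snd < 0 := by simpa using hf2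
      have hj2 : f.snd ≠ i := by rintro h; rw [h] at hf2'; linarith
      have b2 : j ≤ f.snd := hjmin _ hf2'
      constructor <;> constructor <;> simp only [neg, hs] <;> grind

/-- Without negative coordinates, the mass at the first nonzero coordinate is matched with the mass
at the last one; a loop takes what is left at the end. -/
lemma exists_peels_of_nonneg {x : Fin n → ℝ} (hnn : ∀ v, 0 ≤ x v) (h0 : x ≠ 0) :
    ∃ e m, Peels x e m := by
  have hone : (1 : ℤˣ) ≠ -1 := by decide
  have hne : (Finset.univ.filter fun v => 0 < x v).Nonempty := by
    by_contra h
    refine h0 (funext fun v => le_antisymm ?_ (hnn v))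
    by_contra h'
    exact h ⟨v, by simpa using h'⟩
  obtain ⟨i, hi, himin⟩ : ∃ i, 0 < x i ∧ ∀ v, 0 < x v → i ≤ v := by
    obtain ⟨i, hi, h⟩ := Finset.exists_min_image _ id hne
    exact ⟨i, by simpa using hi, fun v hv => h v (by simpa using hv)⟩
  obtain ⟨j, hj, hjmax⟩ : ∃ j, 0 < x j ∧ ∀ v, 0 < x v → v ≤ j := by
    obtain ⟨i, hi, h⟩ := Finset.exists_max_image _ id hne
    exact ⟨i, by simpa using hi, fun v hv => h v (by simpa using hv)⟩
  have hpos : ∀ c, IsRep x c → ∀ f, c f ≠ 0 → f.sign = 1 := by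
    intro c hc f hf
    rcases f.sign_cases with h | h
    · exact h
    · exact absurd (hc.snd_neg hf h) (not_lt.2 (hnn _))
  rcases (himin j hj).eq_or_lt with rfl | hij
  · have hx : x = (x i / 2) • (pos i i le_rfl).vec := by
      funext v
      by_cases hv : v = i
      · subst hv; simp [pos, vec_apply]; ring
      · have : x v = 0 := by
          by_contra h
          have hp := lt_of_le_of_ne (hnn v) (Ne.symm h)
          exact hv (le_antisymm (hjmax v hp) (himin v hp))
        simp [pos, vec_apply, hv, this]
    have hx' : x - (x i / 2) • (pos i i le_rfl).vec = 0 := sub_eq_zero.2 hx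
    refine ⟨pos i i le_rfl, x i / 2, ?_, ?_, ?_, ?_⟩
    · rw [hx']; intro k; simp [prefixSum]
    · rw [hx']
      simp only [Pi.zero_apply, ne_eq, not_true_eq_false, Finset.filter_false, Finset.card_empty]
      exact Finset.card_pos.2 ⟨i, by simp [hi.ne']⟩
    · intro c hc
      have := hc.apply_eq_of_forall (e := pos i i le_rfl) (v := i) fun f hf _ => by
        have p1 := hc.fst_pos hf
        have p2 := hc.snd_pos hf (hpos c hc f hf)
        exact SignedEdge.ext (le_antisymm (hjmax _ p1) (himin _ p1))
          (le_antisymm (hjmax _ p2) (himin _ p2)) (hpos c hc f hf)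
      rw [this]
      simp [pos, vec_apply]
      ring
    · intro c hc
      rw [hx'] at hc
      have := hc.add_single (e := pos i i le_rfl) (m := x i / 2) (by linarith) fun f hf =>
        absurd (hc.fst_pos hf) (lt_irrefl _)
      rwa [zero_add, ← hx] at this
  · refine peels_of_lt (x := x) (e := pos i j hij.le) hij hi (by simpa [pos] using hj) ?_ ?_ ?_
    · intro m hm0 hmi hmj k
      refine Finset.sum_nonneg fun v _ => ?_
      simp only [pos, Units.val_one, Int.cast_one, one_mul] at hmi hmj
      have := hnn v
      simp only [Pi.sub_apply, Pi.smul_apply, smul_eq_mul, vec_apply, pos]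
      by_cases h1 : v = i <;> by_cases h2 : v = j
      · exact absurd (h1.symm.trans h2) hij.ne
      · subst h1; simpa [h2] using hmi
      · subst h2; simpa [h1] using hmj
      · simpa [h1, h2] using this
    · intro c hc
      simp only [pos]
      by_contra! hno
      obtain ⟨⟨f, hf, hfi, hfe⟩, ⟨g, hg, hgj, hge⟩⟩ := hno
      have hfs := hpos c hc f hf
      have hgs := hpos c hc g hg
      have f1 := himin _ (hc.fst_pos hf)
      have f2 := hjmax _ (hc.snd_pos hf hfs)
      have g1 := himin _ (hc.fst_pos hg)
      have g2 := hjmax _ (hc.snd_pos hg hgs)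
      have hfl := f.fst_le_snd
      have hgl := g.fst_le_snd
      have hfi' : f.fst = i := by grind
      have hgj' : g.snd = j := by grind
      have hfj : f.snd ≠ j := fun h => hfe (SignedEdge.ext hfi' h hfs)
      have hgi : g.fst ≠ i := fun h => hge (SignedEdge.ext h hgj' hgs)
      have c1 := hc.compat f hf g hg
      have c2 := hc.compat g hg f hf
      have a1 := c1.pos_pos hfs hgs
      have a2 := fun h => c1.loop_pos h hgs
      have a3 := fun h => c2.loop_pos h hfs
      have a4 := c1.loop_loop
      have a5 := c1.noncrossing
      grind
    · intro f hf1 hf2 hav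
      have hle := f.fst_le_snd
      simp only [pos] at hav
      have hs : f.sign = 1 := by
        rcases f.sign_cases with h | h
        · exact h
        · rw [h] at hf2
          simp at hf2
          exact absurd hf2 (not_lt.2 (hnn _))
      have hf2' : 0 < x f.snd := by simpa [hs] using hf2
      have f1 := himin _ hf1
      have f2 := hjmax _ hf2'
      constructor <;> constructor <;> simp only [pos, hs] <;> grind

lemma exists_peels {x : Fin n → ℝ} (hx : x ∈ prefixCone n) (h0 : x ≠ 0) :
    ∃ e m, Peels x e m := by
  by_cases h : ∃ v, x v < 0
  · exact exists_peels_of_neg hx h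
  · push Not at h
    exact exists_peels_of_nonneg h h0

theorem existsUnique_isRep {x : Fin n → ℝ} (hx : x ∈ prefixCone n) : ∃! c, IsRep x c := by
  induction hk : (Finset.univ.filter fun v => x v ≠ 0).card using Nat.strong_induction_on
    generalizing x with
  | _ k ih =>
  by_cases h0 : x = 0
  · subst h0
    refine ⟨0, ⟨fun _ => le_rfl, fun e he => absurd rfl he, by simp⟩, fun c hc => ?_⟩
    funext e
    by_contra he
    exact absurd (hc.fst_pos he) (lt_irrefl _)
  · obtain ⟨e, m, hp⟩ := exists_peels hx h0
    obtain ⟨c, hc, huniq⟩ := ih _ (hk ▸ hp.card_lt) hp.mem rfl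
    refine ⟨_, hp.isRep_add c hc, fun d hd => ?_⟩
    have hde := hp.coeff_eq d hd
    have hrep : IsRep (x - m • e.vec) (d - Pi.single e m) := by
      refine ⟨fun f => ?_, hd.compat.mono fun f hf hdf => ?_, ?_⟩
      · by_cases hf : f = e
        · subst hf; simp [hde]
        · simpa [hf] using hd.nonneg f
      · refine hf ?_
        by_cases hfe : f = e
        · subst hfe; simp [hde]
        · simpa [hfe] using hdf
      · simp only [Pi.sub_apply, sub_smul, Finset.sum_sub_distrib, hd.sum_eq]
        congr 1
        rw [Finset.sum_eq_single e (fun f _ hf => by simp [hf]) (by simp)]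
        simp
    rw [← huniq _ hrep, sub_add_cancel]

lemma mem_prefixCone_of_sum {c : SignedEdge n → ℝ} (hc : ∀ e, 0 ≤ c e) :
    ∑ e, c e • e.vec ∈ prefixCone n := by
  intro k
  have : prefixSum (∑ e, c e • e.vec) k = ∑ e, c e * prefixSum e.vec k := by
    simp only [prefixSum, Finset.sum_apply, Pi.smul_apply, smul_eq_mul, Finset.mul_sum]
    rw [Finset.sum_comm]
  rw [this]
  exact Finset.sum_nonneg fun e _ => mul_nonneg (hc e) (vec_mem_prefixCone e k)

/-- Two representations with the same sum coincide. -/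
lemma IsRep.unique {x : Fin n → ℝ} {c d : SignedEdge n → ℝ} (hc : IsRep x c) (hd : IsRep x d) :
    c = d :=
  (existsUnique_isRep (hc.sum_eq ▸ mem_prefixCone_of_sum hc.nonneg)).unique hc hd

end Existence

/-! ### Compatible edge sets and alternating well-structured graphs -/

section Graphs

variable {n : ℕ}

lemma SignedGraph.isCompatible {G : SignedGraph n} (ha : G.IsAlternating)
    (hw : G.IsWellStructured) : IsCompatible {e | e ∈ G.edges} := by
  intro e he f hf
  refine ⟨fun h => ?_, fun h => ?_, hw.noncrossing e he f hf, hw.pos_pos e he f hf,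
    hw.loop_pos e he f hf, hw.loop_neg e he f hf, hw.pos_neg e he f hf, fun h1 h2 => ?_⟩
  · exact (ha e.fst e he f hf _ _ e.incidentWith_fst (Or.inr ⟨h, rfl⟩)).symm
  · exact ha e.snd e he f hf _ _ e.incidentWith_snd (Or.inr ⟨h, rfl⟩)
  · have h := hw.one_loop
    rw [SignedGraph.numLoops, Multiset.countP_eq_card_filter, Multiset.card_eq_one] at h
    obtain ⟨a, h⟩ := h
    have he' : e ∈ ({a} : Multiset (SignedEdge n)) :=
      h ▸ Multiset.mem_filter.2 ⟨he, h1⟩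
    have hf' : f ∈ ({a} : Multiset (SignedEdge n)) :=
      h ▸ Multiset.mem_filter.2 ⟨hf, h2⟩
    rw [Multiset.mem_singleton] at he' hf'
    rw [he', hf']

lemma SignedGraph.nodup {G : SignedGraph n} (hw : G.IsWellStructured) : G.edges.Nodup := by
  rw [Multiset.nodup_iff_count_le_one]
  intro e
  by_contra! h
  have h2 : Multiset.replicate 2 e ≤ G.edges := Multiset.le_count_iff_replicate_le.1 h
  rcases e.fst_le_snd.eq_or_lt with hl | hl
  · have h3 := Multiset.countP_le_of_le (fun e : SignedEdge n => e.fst = e.snd) h2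
    have h4 := hw.one_loop
    rw [SignedGraph.numLoops] at h4
    rw [h4] at h3
    rw [Multiset.countP_eq_card.2 fun a ha => by rwa [Multiset.eq_of_mem_replicate ha],
      Multiset.card_replicate] at h3
    omega
  · have h3 := (Multiset.countP_le_of_le (fun f : SignedEdge n => f.fst = e.fst ∧ f.snd = e.snd)
      h2).trans (hw.no_nonloop_cycle.1 e.fst e.snd hl)
    rw [Multiset.countP_eq_card.2 fun a ha => by rw [Multiset.eq_of_mem_replicate ha]; simp,
      Multiset.card_replicate] at h3
    omega

lemma SignedGraph.adj_iff {G : SignedGraph n} {u v : Fin n} :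
    G.toSimpleGraph.Adj u v ↔ u ≠ v ∧ ∃ e ∈ G.edges,
      (e.fst = u ∧ e.snd = v) ∨ (e.fst = v ∧ e.snd = u) := by
  rw [SignedGraph.toSimpleGraph, SimpleGraph.fromRel_adj]
  refine and_congr_right fun _ => ⟨?_, ?_⟩
  · rintro (⟨e, he, h⟩ | ⟨e, he, h⟩)
    · exact ⟨e, he, Or.inl h⟩
    · exact ⟨e, he, Or.inr h⟩
  · rintro ⟨e, he, h | h⟩
    · exact Or.inl ⟨e, he, h⟩
    · exact Or.inr ⟨e, he, h⟩

/-- A connected graph with a loop spans: the loop yields `e_i`, and every edge transports a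
coordinate vector from one end to the other. -/
lemma SignedGraph.span_eq_top {G : SignedGraph n} (hc : G.toSimpleGraph.Connected)
    (hl : G.numLoops = 1) : Submodule.span ℝ (vec '' {e | e ∈ G.edges}) = ⊤ := by
  obtain ⟨W, hW⟩ : ∃ W, W = Submodule.span ℝ (vec '' {e | e ∈ G.edges}) := ⟨_, rfl⟩
  have hmem : ∀ e ∈ G.edges, e.vec ∈ W := fun e he => hW ▸ Submodule.subset_span ⟨e, he, rfl⟩
  rw [← hW]
  obtain ⟨a, ha, haa⟩ : ∃ a ∈ G.edges, a.fst = a.snd := by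
    rw [← Multiset.countP_pos]
    rw [SignedGraph.numLoops] at hl
    omega
  have h0 : (Pi.single a.fst 1 : Fin n → ℝ) ∈ W := by
    have h1 := W.smul_mem (1 / 2 : ℝ) (hmem a ha)
    have h2 : (1 / 2 : ℝ) • a.vec = Pi.single a.fst 1 := by
      rw [vec, a.loop_pos haa, ← haa]
      simp only [Units.val_one, Int.cast_one, one_smul]
      rw [← two_smul ℝ, smul_smul]
      norm_num
    rwa [h2] at h1
  have hall : ∀ v, (Pi.single v 1 : Fin n → ℝ) ∈ W := by
    intro v
    have hr : G.toSimpleGraph.Reachable a.fst v := hc.preconnected _ _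
    rw [SimpleGraph.reachable_iff_reflTransGen] at hr
    induction hr with
    | refl => exact h0
    | tail _ hadj ih =>
      obtain ⟨_, e, he, ⟨rfl, rfl⟩ | ⟨rfl, rfl⟩⟩ := SignedGraph.adj_iff.1 hadj
      · have h1 := W.smul_mem ((e.sign : ℤ) : ℝ) (W.sub_mem (hmem e he) ih)
        rcases e.sign_cases with hs | hs <;> simpa [vec, hs] using h1
      · have h1 := W.sub_mem (hmem e he) (W.smul_mem ((e.sign : ℤ) : ℝ) ih)
        simpa [vec] using h1
  rw [eq_top_iff]
  intro x _
  rw [pi_eq_sum_univ' x]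
  refine W.sum_mem fun v _ => W.smul_mem _ ?_
  exact hall v

/-- Compatible edges have linearly independent vectors: the positive and the negative part of a
linear relation would be two representations of the same vector. -/
lemma SignedEdge.IsCompatible.linearIndependent {S : Set (SignedEdge n)} (hS : IsCompatible S) :
    LinearIndependent ℝ (fun e : S => e.1.vec) := by
  classical
  rw [Fintype.linearIndependent_iff]
  intro g hg e
  obtain ⟨d, hd⟩ : ∃ d : SignedEdge n → ℝ, d = fun e => if h : e ∈ S then g ⟨e, h⟩ else 0 :=
    ⟨_, rfl⟩
  have hdS : ∀ e, e ∉ S → d e = 0 := fun e he => by simp [hd, he]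
  have hsum : ∑ e, d e • e.vec = 0 := by
    rw [← hg, ← Finset.sum_subset (Finset.subset_univ S.toFinset)]
    · rw [← Finset.sum_coe_sort S.toFinset]
      refine Fintype.sum_equiv (Equiv.subtypeEquivRight (by simp)) _ _ fun e => ?_
      have : (e : SignedEdge n) ∈ S := Set.mem_toFinset.1 e.2
      simp only [hd, this, dif_pos]
      rfl
    · intro e _ he
      rw [hdS e (by simpa using he), zero_smul]
  have h1 : IsRep (∑ e, max (d e) 0 • e.vec) (fun e => max (d e) 0) :=
    ⟨fun _ => le_max_right _ _, hS.mono fun e he => by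
      by_contra h; exact he (by simp [hdS e h]), rfl⟩
  have h2 : IsRep (∑ e, max (d e) 0 • e.vec) (fun e => max (-d e) 0) :=
    ⟨fun _ => le_max_right _ _, hS.mono fun e he => by
      by_contra h; exact he (by simp [hdS e h]), by
      rw [← sub_eq_zero, ← Finset.sum_sub_distrib]
      rw [← neg_eq_zero, ← Finset.sum_neg_distrib, ← hsum]
      refine Finset.sum_congr rfl fun e _ => ?_
      rw [← sub_smul, ← neg_smul]
      congr 1
      rcases le_total (d e) 0 with h | h
      · rw [max_eq_right h, max_eq_left (by linarith)]; ring
      · rw [max_eq_left h, max_eq_right (by linarith)]; ring⟩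
  have h3 := congrFun (h1.unique h2) e.1
  have h4 : d e.1 = g e := by simp [hd]
  rw [← h4]
  rcases le_total (d e.1) 0 with h | h
  · rw [max_eq_right h, max_eq_left (by linarith)] at h3; linarith
  · rw [max_eq_left h, max_eq_right (by linarith)] at h3; linarith

lemma SignedEdge.IsCompatible.vec_injOn {S : Set (SignedEdge n)} (hS : IsCompatible S) :
    Set.InjOn vec S := by
  intro e he f hf h
  have := hS.linearIndependent.injective (a₁ := ⟨e, he⟩) (a₂ := ⟨f, hf⟩) h
  exact congrArg Subtype.val this

lemma SignedEdge.IsCompatible.card_eq {S : Finset (SignedEdge n)} (hS : IsCompatible (S : Set (SignedEdge n)))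
    (hspan : Submodule.span ℝ (vec '' (S : Set (SignedEdge n))) = ⊤) : S.card = n := by
  have h := finrank_span_eq_card hS.linearIndependent
  have hr : Set.range (fun e : (S : Set (SignedEdge n)) => e.1.vec) =
      vec '' (S : Set (SignedEdge n)) := by
    ext; simp
  rw [hr, hspan, finrank_top] at h
  simpa using h.symm

/-- Among compatible edges the positive nonloop ones are nested around a common gap, and this gap
can be chosen such that no negative edge straddles it. Hence the functional which is `1` before and
`-1` after the gap vanishes on all nonloop edges. -/
lemma SignedEdge.IsCompatible.exists_functional {S : Set (SignedEdge n)} (hS : IsCompatible S) :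
    ∃ y : Fin n → ℝ, (∀ v, y v ≠ 0) ∧
      ∀ e ∈ S, e.fst < e.snd → y e.fst + ((e.sign : ℤ) : ℝ) * y e.snd = 0 := by
  classical
  by_cases hpos : ∃ e ∈ S, e.fst < e.snd ∧ e.sign = 1
  · obtain ⟨p, hpS, hplt, hps, hpmax⟩ : ∃ p ∈ S, p.fst < p.snd ∧ p.sign = 1 ∧
        ∀ e ∈ S, e.fst < e.snd → e.sign = 1 → e.fst ≤ p.fst := by
      obtain ⟨e, he⟩ := hpos
      obtain ⟨p, hp, h⟩ := Finset.exists_max_image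
        (Finset.univ.filter fun e : SignedEdge n => e ∈ S ∧ e.fst < e.snd ∧ e.sign = 1)
        SignedEdge.fst ⟨e, by simpa using he⟩
      rw [Finset.mem_filter] at hp
      exact ⟨p, hp.2.1, hp.2.2.1, hp.2.2.2, fun e h1 h2 h3 => h e (by simp [h1, h2, h3])⟩
    -- The gap is to the right of the longest negative edge that starts where `p` starts.
    obtain ⟨m, hm⟩ : ∃ m : Fin n, (∀ e ∈ S, e.sign = 1 → e.fst < e.snd → e.fst ≤ m ∧ m < e.snd) ∧
        ∀ e ∈ S, e.sign = -1 → (e.fst ≤ m ↔ e.snd ≤ m) := by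
      have hcross : ∀ f ∈ S, f.sign = -1 → f.fst < p.fst → p.fst < f.snd → False := by
        intro f hf hs h1 h2
        have a1 := (hS p hpS f hf).snd_snd
        have a2 := (hS f hf p hpS).noncrossing
        have a3 := (hS p hpS f hf).pos_neg hps hs
        have hone : (1 : ℤˣ) ≠ -1 := by decide
        grind
      by_cases hneg : ∃ e ∈ S, e.sign = -1 ∧ e.fst = p.fst
      · obtain ⟨q, hqS, hqs, hqf, hqmax⟩ : ∃ q ∈ S, q.sign = -1 ∧ q.fst = p.fst ∧
            ∀ e ∈ S, e.sign = -1 → e.fst = p.fst → e.snd ≤ q.snd := by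
          obtain ⟨e, he⟩ := hneg
          obtain ⟨q, hq, h⟩ := Finset.exists_max_image
            (Finset.univ.filter fun e : SignedEdge n => e ∈ S ∧ e.sign = -1 ∧ e.fst = p.fst)
            SignedEdge.snd ⟨e, by simpa using he⟩
          rw [Finset.mem_filter] at hq
          exact ⟨q, hq.2.1, hq.2.2.1, hq.2.2.2, fun e h1 h2 h3 => h e (by simp [h1, h2, h3])⟩
        have hqlt := fst_lt_snd_of_neg hqs
        refine ⟨q.snd, fun e he hs hlt => ?_, fun e he hs => ?_⟩
        · have b1 := hpmax e he hlt hs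
          have a1 := (hS e he q hqS).snd_snd
          have a2 := (hS e he q hqS).noncrossing
          have a3 := (hS e he q hqS).pos_neg hs hqs
          have a4 := (hS e he p hpS).pos_pos hs hps hlt hplt
          have hone : (1 : ℤˣ) ≠ -1 := by decide
          grind
        · have hlt := fst_lt_snd_of_neg hs
          have b1 := hqmax e he hs
          have b2 := hcross e he hs
          have a1 := (hS e he q hqS).fst_snd
          have a2 := (hS q hqS e he).noncrossing
          have hone : (1 : ℤˣ) ≠ -1 := by decide
          grind
      · refine ⟨p.fst, fun e he hs hlt => ?_, fun e he hs => ?_⟩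
        · exact ⟨hpmax e he hlt hs, ((hS e he p hpS).pos_pos hs hps hlt hplt).2⟩
        · have hlt := fst_lt_snd_of_neg hs
          have b2 := hcross e he hs
          have b3 : e.fst ≠ p.fst := fun h => hneg ⟨e, he, hs, h⟩
          grind
    refine ⟨fun v => if v ≤ m then 1 else -1, fun v => ?_, fun e he hlt => ?_⟩
    · dsimp only; split_ifs <;> norm_num
    · rcases e.sign_cases with hs | hs
      · have := hm.1 e he hs hlt
        simp [hs, this.1, not_le.2 this.2]
      · have := hm.2 e he hs
        by_cases h : e.fst ≤ m
        · simp [hs, h, this.1 h]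
        · simp [hs, h, mt this.2 h]
  · refine ⟨fun _ => 1, fun _ => one_ne_zero, fun e he hlt => ?_⟩
    rcases e.sign_cases with hs | hs
    · exact absurd ⟨e, he, hlt, hs⟩ hpos
    · simp [hs]

/-- The graph with edge set `S`, every edge having multiplicity one. -/
def graphOf (S : Finset (SignedEdge n)) : SignedGraph n := ⟨S.val⟩

/-- A connected component without a loop would be annihilated by a nonzero functional. -/
lemma SignedEdge.IsCompatible.exists_loop_reachable {S : Finset (SignedEdge n)}
    (hS : IsCompatible (S : Set (SignedEdge n)))
    (hspan : Submodule.span ℝ (vec '' (S : Set (SignedEdge n))) = ⊤) (v : Fin n) :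
    ∃ a ∈ S, a.fst = a.snd ∧ (graphOf S).toSimpleGraph.Reachable v a.fst := by
  classical
  by_contra! hno
  obtain ⟨y, hy0, hy⟩ := hS.exists_functional
  obtain ⟨z, hz⟩ : ∃ z : Fin n → ℝ,
      z = fun w => if (graphOf S).toSimpleGraph.Reachable v w then y w else 0 := ⟨_, rfl⟩
  have hker : ∀ x : Fin n → ℝ, ∑ w, z w * x w = 0 := by
    intro x
    have hx : x ∈ Submodule.span ℝ (vec '' (S : Set (SignedEdge n))) := hspan ▸ Submodule.mem_top
    induction hx using Submodule.span_induction with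
    | mem x hx =>
      obtain ⟨e, he, rfl⟩ := hx
      rw [sum_mul_vec]
      rcases e.fst_le_snd.eq_or_lt with h | h
      · have h1 := hno e he h
        have h2 := h ▸ h1
        simp [hz, h1, h2]
      · have hadj : (graphOf S).toSimpleGraph.Adj e.fst e.snd :=
          SignedGraph.adj_iff.2 ⟨h.ne, e, he, Or.inl ⟨rfl, rfl⟩⟩
        by_cases h1 : (graphOf S).toSimpleGraph.Reachable v e.fst
        · simpa [hz, h1, h1.trans hadj.reachable] using hy e he h
        · have h2 : ¬ (graphOf S).toSimpleGraph.Reachable v e.snd :=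
            fun h2 => h1 (h2.trans hadj.symm.reachable)
          simp [hz, h1, h2]
    | zero => simp
    | add x y _ _ hx hy => simp [mul_add, Finset.sum_add_distrib, hx, hy]
    | smul a x _ hx =>
      simp only [Pi.smul_apply, smul_eq_mul, mul_left_comm _ a, ← Finset.mul_sum, hx, mul_zero]
  have := hker (Pi.single v 1)
  simp [hz, Pi.single_apply, hy0] at this

/-- A set of compatible edges whose vectors span is the edge set of an alternating well-structured
graph. -/
lemma SignedEdge.IsCompatible.isWellStructured {S : Finset (SignedEdge n)} (hn : 1 ≤ n)
    (hS : IsCompatible (S : Set (SignedEdge n)))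
    (hspan : Submodule.span ℝ (vec '' (S : Set (SignedEdge n))) = ⊤) :
    (graphOf S).IsAlternating ∧ (graphOf S).IsWellStructured := by
  classical
  refine ⟨fun v e he f hf s t h1 h2 => hS.sign_eq he hf h1 h2, ?_⟩
  have hloop := hS.exists_loop_reachable hspan
  have hcard := hS.card_eq hspan
  have hconn : (graphOf S).toSimpleGraph.Connected := by
    have : Nonempty (Fin n) := ⟨⟨0, hn⟩⟩
    refine ⟨fun u v => ?_⟩
    obtain ⟨a, ha, hal, hua⟩ := hloop u
    obtain ⟨b, hb, hbl, hvb⟩ := hloop v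
    rw [← (hS a ha b hb).loop_loop hal hbl] at hvb
    exact hua.trans hvb.symm
  have hone : (S.filter fun e => e.fst = e.snd).card = 1 := by
    obtain ⟨a, ha, hal, -⟩ := hloop ⟨0, hn⟩
    rw [Finset.card_eq_one]
    refine ⟨a, Finset.eq_singleton_iff_unique_mem.2 ⟨by simp [ha, hal], fun b hb => ?_⟩⟩
    rw [Finset.mem_filter] at hb
    have h1 := (hS b hb.1 a ha).loop_loop hb.2 hal
    refine SignedEdge.ext h1 (hb.2 ▸ hal ▸ h1) ?_
    rw [a.loop_pos hal, b.loop_pos hb.2]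
  refine ⟨fun e he f hf => (hS e he f hf).noncrossing, fun e he f hf => (hS e he f hf).pos_pos,
    fun e he f hf => (hS e he f hf).loop_pos, fun e he f hf => (hS e he f hf).loop_neg,
    fun e he f hf => (hS e he f hf).pos_neg, hconn, ?_, ?_, ?_⟩
  · rw [SignedGraph.numLoops, Multiset.countP_eq_card_filter]
    exact hone
  · intro i j _
    rw [Multiset.countP_eq_card_filter]
    change (S.filter fun e => e.fst = i ∧ e.snd = j).card ≤ 1
    rw [Finset.card_le_one]
    intro e he f hf
    rw [Finset.mem_filter] at he hf
    have h2 := he.2.2.trans hf.2.2.symm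
    exact SignedEdge.ext (he.2.1.trans hf.2.1.symm) h2 ((hS e he.1 f hf.1).snd_snd h2)
  · -- A connected graph with `n - 1` edges is a tree.
    refine (SimpleGraph.isTree_iff_connected_and_card.2 ⟨hconn, le_antisymm ?_ ?_⟩).isAcyclic
    · have hsub : (graphOf S).toSimpleGraph.edgeSet ⊆
          (((S.filter fun e => ¬ e.fst = e.snd).image fun e => s(e.fst, e.snd) :
            Finset (Sym2 (Fin n))) : Set (Sym2 (Fin n))) := by
        intro z hz
        induction z with
        | _ u v =>
        rw [SimpleGraph.mem_edgeSet] at hz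
        obtain ⟨huv, e, he, ⟨rfl, rfl⟩ | ⟨rfl, rfl⟩⟩ := SignedGraph.adj_iff.1 hz
        · exact Finset.mem_coe.2 (Finset.mem_image.2 ⟨e, Finset.mem_filter.2 ⟨he, huv⟩, rfl⟩)
        · exact Finset.mem_coe.2 (Finset.mem_image.2
            ⟨e, Finset.mem_filter.2 ⟨he, huv.symm⟩, Sym2.eq_swap⟩)
      have h1 := Set.ncard_le_ncard hsub (Finset.finite_toSet _)
      rw [Set.ncard_coe_finset] at h1
      have h2 := h1.trans Finset.card_image_le
      have h3 := Finset.card_filter_add_card_filter_not (s := S) (fun e => e.fst = e.snd)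
      rw [Nat.card_coe_set_eq, Nat.card_eq_fintype_card, Fintype.card_fin]
      omega
    · exact hconn.card_vert_le_card_edgeSet_add_one

end Graphs

/-! ### The triangulation -/

section Polytopes

variable {n : ℕ}

lemma mem_convexHull_insert_zero_iff {S : Set (SignedEdge n)} {x : Fin n → ℝ} :
    x ∈ convexHull ℝ (insert 0 (vec '' S)) ↔ ∃ c : SignedEdge n → ℝ, (∀ e, 0 ≤ c e) ∧
      (∀ e, c e ≠ 0 → e ∈ S) ∧ ∑ e, c e ≤ 1 ∧ ∑ e, c e • e.vec = x := by
  classical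
  constructor
  · intro hx
    refine convexHull_min (t := {x | ∃ c : SignedEdge n → ℝ, (∀ e, 0 ≤ c e) ∧
      (∀ e, c e ≠ 0 → e ∈ S) ∧ ∑ e, c e ≤ 1 ∧ ∑ e, c e • e.vec = x}) ?_ ?_ hx
    · rintro _ (rfl | ⟨e, he, rfl⟩)
      · exact ⟨0, fun _ => le_rfl, fun e he => absurd rfl he, by simp, by simp⟩
      · refine ⟨Pi.single e 1, fun f => ?_, fun f hf => ?_, by simp, ?_⟩
        · by_cases h : f = e
          · subst h; simp
          · simp [h]
        · by_cases h : f = e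
          · exact h ▸ he
          · simp [h] at hf
        · rw [Finset.sum_eq_single e (fun f _ hf => by simp [hf]) (by simp)]
          simp
    · rintro x ⟨c, hc, hcS, hc1, rfl⟩ y ⟨d, hd, hdS, hd1, rfl⟩ a b ha hb hab
      refine ⟨a • c + b • d, fun e => ?_, fun e he => ?_, ?_, ?_⟩
      · exact add_nonneg (mul_nonneg ha (hc e)) (mul_nonneg hb (hd e))
      · by_cases h : c e = 0
        · refine hdS e fun h' => he ?_
          simp [h, h']
        · exact hcS e h
      · simp only [Pi.add_apply, Pi.smul_apply, smul_eq_mul, Finset.sum_add_distrib,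
          ← Finset.mul_sum]
        nlinarith
      · simp only [Pi.add_apply, Pi.smul_apply, smul_eq_mul, add_smul, Finset.sum_add_distrib,
          mul_smul, ← Finset.smul_sum]
  · rintro ⟨c, hc, hcS, hc1, rfl⟩
    have h := (convex_convexHull ℝ (insert 0 (vec '' S))).sum_mem
      (t := (Finset.univ : Finset (Option (SignedEdge n))))
      (w := fun o => o.elim (1 - ∑ e, c e) c)
      (z := fun o => o.elim 0 fun e => if e ∈ S then e.vec else 0) ?_ ?_ ?_
    · rw [Fintype.sum_option] at h
      simp only [Option.elim_none, Option.elim_some, smul_zero, zero_add] at h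
      convert h using 1
      refine Finset.sum_congr rfl fun e _ => ?_
      by_cases he : e ∈ S
      · rw [if_pos he]
      · rw [not_not.1 (mt (hcS e) he)]; simp
    · rintro (_ | e) _
      · simpa using hc1
      · exact hc e
    · rw [Fintype.sum_option]; simp
    · rintro (_ | e) _
      · exact subset_convexHull _ _ (Set.mem_insert _ _)
      · dsimp only [Option.elim_some]
        split_ifs with he
        · exact subset_convexHull _ _ (Set.mem_insert_of_mem _ ⟨e, he, rfl⟩)
        · exact subset_convexHull _ _ (Set.mem_insert _ _)

lemma isRep_single (e : SignedEdge n) : IsRep e.vec (Pi.single e 1) := by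
  have h0 : IsRep (0 : Fin n → ℝ) 0 := ⟨fun _ => le_rfl, fun e he => absurd rfl he, by simp⟩
  simpa using h0.add_single (e := e) zero_le_one (fun f hf => absurd rfl hf)

lemma sum_abs_vec (e : SignedEdge n) : ∑ v, |e.vec v| = 2 := by
  rw [← (isRep_single e).two_mul_sum]
  simp

lemma positiveRoots_eq_range : positiveRoots n = Set.range vec := by
  ext x
  constructor
  · rintro (⟨i, j, hij, rfl⟩ | ⟨i, j, hij, rfl⟩ | ⟨k, rfl⟩)
    · exact ⟨neg i j hij, by simp [vec, neg, sub_eq_add_neg]⟩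
    · exact ⟨pos i j hij.le, by simp [vec, pos]⟩
    · exact ⟨pos k k le_rfl, by simp [vec, pos, two_smul]⟩
  · rintro ⟨e, rfl⟩
    rcases e.fst_le_snd.eq_or_lt with h | h
    · refine Or.inr (Or.inr ⟨e.fst, ?_⟩)
      rw [vec, e.loop_pos h, ← h, two_smul]; simp
    · rcases e.sign_cases with hs | hs
      · exact Or.inr (Or.inl ⟨e.fst, e.snd, h, by simp [vec, hs]⟩)
      · exact Or.inl ⟨e.fst, e.snd, h, by simp [vec, hs, sub_eq_add_neg]⟩

/-- The root polytope is cut out of the cone of the positive roots by the `ℓ¹` ball of radius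
`2`. -/
lemma mem_fullRootPolytope_iff {x : Fin n → ℝ} :
    x ∈ fullRootPolytope n ↔ x ∈ prefixCone n ∧ ∑ v, |x v| ≤ 2 := by
  rw [fullRootPolytope, positiveRoots_eq_range, ← Set.image_univ, mem_convexHull_insert_zero_iff]
  constructor
  · rintro ⟨c, hc, -, hc1, rfl⟩
    refine ⟨mem_prefixCone_of_sum hc, ?_⟩
    have h1 : ∀ v, |(∑ e, c e • e.vec) v| ≤ ∑ e, c e * |e.vec v| := by
      intro v
      rw [Finset.sum_apply]
      refine (Finset.abs_sum_le_sum_abs _ _).trans (Finset.sum_le_sum fun e _ => ?_)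
      rw [Pi.smul_apply, smul_eq_mul, abs_mul, abs_of_nonneg (hc e)]
    refine (Finset.sum_le_sum fun v _ => h1 v).trans ?_
    rw [Finset.sum_comm]
    simp only [← Finset.mul_sum, sum_abs_vec, ← Finset.sum_mul]
    linarith
  · rintro ⟨hx, hx2⟩
    obtain ⟨c, hc, -⟩ := existsUnique_isRep hx
    exact ⟨c, hc.nonneg, fun _ _ => Set.mem_univ _, by linarith [hc.two_mul_sum], hc.sum_eq⟩

/-- The transitive closure of an alternating well-structured graph adds no edges, as an edge is the
only representation of its own vector. -/
lemma SignedGraph.transClosure_eq {G : SignedGraph n}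
    (hG : IsCompatible {e | e ∈ G.edges}) : G.transClosure = {e | e ∈ G.edges} := by
  classical
  ext f
  constructor
  · intro hf
    have hf' : f.vec ∈ PointedCone.hull ℝ {v | ∃ e ∈ G.edges, v = e.vec} := hf
    obtain ⟨c, hc, hcS, hcf⟩ : ∃ c : SignedEdge n → ℝ, (∀ e, 0 ≤ c e) ∧
        (∀ e, c e ≠ 0 → e ∈ G.edges) ∧ ∑ e, c e • e.vec = f.vec := by
      generalize f.vec = x at hf'
      induction hf' using Submodule.span_induction with
      | mem x hx =>
        obtain ⟨e, he, rfl⟩ := hx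
        refine ⟨Pi.single e 1, (isRep_single e).nonneg, fun f hf => ?_, (isRep_single e).sum_eq⟩
        by_cases h : f = e
        · exact h ▸ he
        · simp [h] at hf
      | zero => exact ⟨0, fun _ => le_rfl, fun e he => absurd rfl he, by simp⟩
      | add x y _ _ hx hy =>
        obtain ⟨c, hc, hcS, rfl⟩ := hx
        obtain ⟨d, hd, hdS, rfl⟩ := hy
        refine ⟨c + d, fun e => add_nonneg (hc e) (hd e), fun e he => ?_, ?_⟩
        · by_cases h : c e = 0
          · exact hdS e fun h' => he (by simp [h, h'])
          · exact hcS e h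
        · simp [add_smul, Finset.sum_add_distrib]
      | smul a x _ hx =>
        obtain ⟨c, hc, hcS, rfl⟩ := hx
        refine ⟨(a : ℝ) • c, fun e => mul_nonneg a.2 (hc e), fun e he => hcS e fun h => he ?_, ?_⟩
        · simp [h]
        · simp only [Pi.smul_apply, smul_eq_mul, mul_smul, ← Finset.smul_sum]
          rfl
    have hrep : IsRep f.vec c := ⟨hc, hG.mono fun e he => hcS e he, hcf⟩
    have := hrep.unique (isRep_single f)
    exact hcS f (by rw [this]; simp)
  · intro hf
    exact PointedCone.subset_hull ⟨f, hf, rfl⟩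

lemma SignedGraph.rootPolytope_eq {G : SignedGraph n} (hG : IsCompatible {e | e ∈ G.edges}) :
    G.rootPolytope = convexHull ℝ (insert 0 (vec '' {e | e ∈ G.edges})) := by
  rw [SignedGraph.rootPolytope, SignedGraph.transClosure_eq hG]

lemma SignedGraph.mem_rootPolytope_iff {G : SignedGraph n} (hG : IsCompatible {e | e ∈ G.edges})
    {x : Fin n → ℝ} : x ∈ G.rootPolytope ↔
      ∃ c, IsRep x c ∧ (∀ e, c e ≠ 0 → e ∈ G.edges) ∧ ∑ e, c e ≤ 1 := by
  rw [SignedGraph.rootPolytope_eq hG, mem_convexHull_insert_zero_iff]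
  constructor
  · rintro ⟨c, h1, h2, h3, h4⟩
    exact ⟨c, ⟨h1, hG.mono fun e he => h2 e he, h4⟩, h2, h3⟩
  · rintro ⟨c, h1, h2, h3⟩
    exact ⟨c, h1.nonneg, h2, h3, h1.sum_eq⟩

/-- The vertex set of a simplex is the set of its extreme points. -/
lemma IsSimplexOn.coe_eq_extremePoints {V : Finset (Fin n → ℝ)} {S : Set (Fin n → ℝ)}
    (h : IsSimplexOn V S) : (V : Set (Fin n → ℝ)) = S.extremePoints ℝ := by
  classical
  obtain ⟨hV, rfl⟩ := h
  refine Set.Subset.antisymm (fun v hv => ?_) extremePoints_convexHull_subset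
  by_contra hvext
  have hsub : (convexHull ℝ (V : Set (Fin n → ℝ))).extremePoints ℝ ⊆ (V.erase v : Finset _) := by
    intro w hw
    rw [Finset.mem_coe, Finset.mem_erase]
    exact ⟨fun h => hvext (h ▸ hw), extremePoints_convexHull_subset hw⟩
  have hcl : IsClosed (convexHull ℝ ((V.erase v : Finset _) : Set (Fin n → ℝ))) :=
    (Finset.finite_toSet _).isClosed_convexHull ℝ
  have hv' : v ∈ convexHull ℝ ((V.erase v : Finset _) : Set (Fin n → ℝ)) := by
    refine closure_minimal (convexHull_mono hsub) hcl ?_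
    rw [closure_convexHull_extremePoints ((Finset.finite_toSet V).isCompact_convexHull ℝ)
      (convex_convexHull ℝ _)]
    exact subset_convexHull ℝ _ hv
  have hi := hV.convexHull_inter (R := ℝ) (t₁ := V.erase v) (t₂ := {v}) (Finset.erase_subset _ _)
    (Finset.singleton_subset_iff.2 hv)
  have : v ∈ convexHull ℝ (((V.erase v : Finset _) : Set (Fin n → ℝ)) ∩ ({v} : Finset _)) :=
    hi ▸ ⟨hv', by simp⟩
  have he : ((V.erase v : Finset _) : Set (Fin n → ℝ)) ∩ ({v} : Finset _) = ∅ := by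
    ext w; simp +contextual
  rw [he, convexHull_empty] at this
  exact this

/-- Compatible edges with spanning vectors are the nonzero vertices of an `n`-simplex. -/
lemma SignedEdge.IsCompatible.isSimplexOn {S : Finset (SignedEdge n)} [DecidableEq (Fin n → ℝ)]
    (hS : IsCompatible (S : Set (SignedEdge n)))
    (hspan : Submodule.span ℝ (vec '' (S : Set (SignedEdge n))) = ⊤) :
    (insert 0 (S.image vec)).card = n + 1 ∧
    IsSimplexOn (insert 0 (S.image vec))
      (convexHull ℝ (insert 0 (vec '' (S : Set (SignedEdge n))))) := by
  have hne : ∀ v ∈ vec '' (S : Set (SignedEdge n)), v ≠ 0 := by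
    rintro _ ⟨e, -, rfl⟩ h0
    have := sum_abs_vec e
    simp [h0] at this
  refine ⟨?_, ?_, by simp⟩
  · rw [Finset.card_insert_of_notMem, Finset.card_image_of_injOn hS.vec_injOn, hS.card_eq hspan]
    intro h
    exact hne 0 (by simpa using h) rfl
  · have hli : LinearIndependent ℝ (fun v => v : vec '' (S : Set (SignedEdge n)) → Fin n → ℝ) := by
      have := hS.linearIndependent.linearIndepOn_id
      have hr : Set.range (fun e : (S : Set (SignedEdge n)) => e.1.vec) =
          vec '' (S : Set (SignedEdge n)) := by
        ext; simp
      rw [hr] at this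
      exact this
    have h1 := (linearIndependent_set_iff_affineIndependent_vadd_union_singleton ℝ hne
      (0 : Fin n → ℝ)).1 hli
    have h2 : ({0} ∪ (fun v => v +ᵥ (0 : Fin n → ℝ)) '' (vec '' (S : Set (SignedEdge n))) :
        Set (Fin n → ℝ)) = ((insert 0 (S.image vec) : Finset _) : Set (Fin n → ℝ)) := by
      simp
    rw [h2] at h1
    exact h1

lemma span_range_vec : Submodule.span ℝ (Set.range (vec (n := n))) = ⊤ := by
  rw [eq_top_iff]
  intro x _
  rw [pi_eq_sum_univ' x]
  refine Submodule.sum_mem _ fun v _ => Submodule.smul_mem _ _ ?_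
  have h : (Pi.single v 1 : Fin n → ℝ) = (1 / 2 : ℝ) • (pos v v le_rfl).vec := by
    simp only [vec, pos, Units.val_one, Int.cast_one, one_smul]
    rw [← two_smul ℝ, smul_smul]
    norm_num
  change (Pi.single v 1 : Fin n → ℝ) ∈ _
  rw [h]
  exact Submodule.smul_mem _ _ (Submodule.subset_span ⟨_, rfl⟩)

lemma interior_fullRootPolytope_nonempty : (interior (fullRootPolytope n)).Nonempty := by
  rw [fullRootPolytope, interior_convexHull_nonempty_iff_affineSpan_eq_top, positiveRoots_eq_range]
  have h : (affineSpan ℝ (insert 0 (Set.range (vec (n := n)))) : Set (Fin n → ℝ)) = Set.univ := by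
    rw [affineSpan_insert_zero, span_range_vec]; rfl
  exact SetLike.coe_injective (h.trans (AffineSubspace.top_coe ℝ _ _).symm)

/-- The points outside all proper subspaces spanned by positive roots are dense. -/
lemma dense_generic : Dense {x : Fin n → ℝ | ∀ S : Finset (SignedEdge n),
    x ∈ Submodule.span ℝ (vec '' (S : Set (SignedEdge n))) →
      Submodule.span ℝ (vec '' (S : Set (SignedEdge n))) = ⊤} := by
  refine Measure.dense_of_ae (μ := volume) ?_
  rw [ae_all_iff]
  intro S
  by_cases h : Submodule.span ℝ (vec '' (S : Set (SignedEdge n))) = ⊤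
  · exact Filter.Eventually.of_forall fun _ _ => h
  · filter_upwards [compl_mem_ae_iff.2 (Measure.addHaar_submodule volume _ h)] with x hx hx'
    exact absurd hx' hx

/-- The index set of the triangulation. -/
abbrev AltWS (n : ℕ) := {T : SignedGraph n // T.IsAlternating ∧ T.IsWellStructured}

namespace AltWS

lemma compat (T : AltWS n) : IsCompatible {e | e ∈ T.1.edges} :=
  SignedGraph.isCompatible T.2.1 T.2.2

lemma span_eq_top (T : AltWS n) : Submodule.span ℝ (vec '' {e | e ∈ T.1.edges}) = ⊤ :=
  SignedGraph.span_eq_top T.2.2.connected T.2.2.one_loop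

/-- The edges as a finset; no edge is repeated. -/
def edgeFinset (T : AltWS n) : Finset (SignedEdge n) := ⟨T.1.edges, SignedGraph.nodup T.2.2⟩

lemma edgeFinset_injective : Function.Injective (edgeFinset (n := n)) := by
  intro T U h
  exact Subtype.ext (SignedGraph.ext (congrArg Finset.val h))

instance : Finite (AltWS n) := Finite.of_injective _ edgeFinset_injective

lemma card_edgeFinset (T : AltWS n) : T.edgeFinset.card = n :=
  IsCompatible.card_eq T.compat T.span_eq_top

lemma isSimplexOn [DecidableEq (Fin n → ℝ)] (T : AltWS n) :
    (insert 0 (T.edgeFinset.image vec)).card = n + 1 ∧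
      IsSimplexOn (insert 0 (T.edgeFinset.image vec)) T.1.rootPolytope := by
  rw [SignedGraph.rootPolytope_eq T.compat]
  exact IsCompatible.isSimplexOn T.compat T.span_eq_top

/-- By uniqueness of representations, two simplices meet in the face spanned by the common
edges. -/
lemma inter_subset (T U : AltWS n) : T.1.rootPolytope ∩ U.1.rootPolytope ⊆
    convexHull ℝ (insert 0 (vec '' {e | e ∈ T.1.edges ∧ e ∈ U.1.edges})) := by
  rintro x ⟨hT, hU⟩
  obtain ⟨c, hc, hcT, hc1⟩ := (SignedGraph.mem_rootPolytope_iff T.compat).1 hT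
  obtain ⟨d, hd, hdU, hd1⟩ := (SignedGraph.mem_rootPolytope_iff U.compat).1 hU
  obtain rfl := hc.unique hd
  exact mem_convexHull_insert_zero_iff.2
    ⟨c, hc.nonneg, fun e he => ⟨hcT e he, hdU e he⟩, hc1, hc.sum_eq⟩

lemma disjoint_interior {T U : AltWS n} (h : T ≠ U) :
    Disjoint (interior T.1.rootPolytope) (interior U.1.rootPolytope) := by
  classical
  rw [Set.disjoint_iff_inter_eq_empty, ← interior_inter, Set.eq_empty_iff_forall_notMem]
  intro x hx
  obtain ⟨S, hS⟩ : ∃ S, S = T.edgeFinset ∩ U.edgeFinset := ⟨_, rfl⟩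
  have hcomm : {e | e ∈ T.1.edges ∧ e ∈ U.1.edges} = (S : Set (SignedEdge n)) := by
    rw [hS, Finset.coe_inter]; rfl
  have hsub : T.1.rootPolytope ∩ U.1.rootPolytope ⊆
      (Submodule.span ℝ (vec '' (S : Set (SignedEdge n))) : Set (Fin n → ℝ)) := by
    refine (inter_subset T U).trans (convexHull_min ?_ (Submodule.convex _))
    rw [hcomm]
    exact Set.insert_subset (Submodule.zero_mem _) Submodule.subset_span
  have htop := Submodule.eq_top_of_nonempty_interior' _ ⟨x, interior_mono hsub hx⟩
  have hST : S ⊆ T.edgeFinset := hS ▸ Finset.inter_subset_left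
  have hSU : S ⊆ U.edgeFinset := hS ▸ Finset.inter_subset_right
  have hcard := (IsCompatible.mono T.compat (Finset.coe_subset.2 hST)).card_eq htop
  refine h (edgeFinset_injective ?_)
  rw [← Finset.eq_of_subset_of_card_le hST (by rw [hcard, card_edgeFinset]),
    ← Finset.eq_of_subset_of_card_le hSU (by rw [hcard, card_edgeFinset])]

lemma inter_eq (T U : AltWS n) {V W : Finset (Fin n → ℝ)} (hV : IsSimplexOn V T.1.rootPolytope)
    (hW : IsSimplexOn W U.1.rootPolytope) :
    T.1.rootPolytope ∩ U.1.rootPolytope = convexHull ℝ ((V : Set (Fin n → ℝ)) ∩ W) := by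
  classical
  refine Set.Subset.antisymm ((inter_subset T U).trans (convexHull_mono ?_)) ?_
  · rw [hV.coe_eq_extremePoints, hW.coe_eq_extremePoints, ← T.isSimplexOn.2.coe_eq_extremePoints,
      ← U.isSimplexOn.2.coe_eq_extremePoints]
    rintro _ (rfl | ⟨e, ⟨heT, heU⟩, rfl⟩)
    · simp
    · exact ⟨Finset.mem_coe.2 (Finset.mem_insert_of_mem (Finset.mem_image_of_mem _ heT)),
        Finset.mem_coe.2 (Finset.mem_insert_of_mem (Finset.mem_image_of_mem _ heU))⟩
  · rw [hV.2, hW.2]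
    exact Set.subset_inter (convexHull_mono Set.inter_subset_left)
      (convexHull_mono Set.inter_subset_right)

lemma rootPolytope_subset (T : AltWS n) : T.1.rootPolytope ⊆ fullRootPolytope n := by
  rw [SignedGraph.rootPolytope_eq T.compat, fullRootPolytope, positiveRoots_eq_range]
  exact convexHull_mono (Set.insert_subset_insert (Set.image_subset_range _ _))

lemma isClosed (T : AltWS n) : IsClosed T.1.rootPolytope := by
  classical
  rw [T.isSimplexOn.2.2]
  exact (Finset.finite_toSet _).isClosed_convexHull ℝ

/-- The edges used by a generic point span, hence form an alternating well-structured graph;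
the other points are limits of generic ones. -/
lemma iUnion_eq (hn : 1 ≤ n) : ⋃ T : AltWS n, T.1.rootPolytope = fullRootPolytope n := by
  classical
  refine Set.Subset.antisymm (Set.iUnion_subset rootPolytope_subset) ?_
  have hcl : IsClosed (⋃ T : AltWS n, T.1.rootPolytope) := isClosed_iUnion_of_finite isClosed
  have hconv : Convex ℝ (fullRootPolytope n) := convex_convexHull ℝ _
  refine subset_closure.trans ?_
  rw [← hconv.closure_interior_eq_closure_of_nonempty_interior interior_fullRootPolytope_nonempty]
  refine closure_minimal ?_ hcl
  refine (dense_generic.open_subset_closure_inter isOpen_interior).trans (closure_minimal ?_ hcl)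
  rintro x ⟨hx, hgen⟩
  obtain ⟨hx, hx2⟩ := mem_fullRootPolytope_iff.1 (interior_subset hx)
  obtain ⟨c, hc, -⟩ := existsUnique_isRep hx
  obtain ⟨S, hS⟩ : ∃ S : Finset (SignedEdge n), S = Finset.univ.filter fun e => c e ≠ 0 :=
    ⟨_, rfl⟩
  have hSc : (S : Set (SignedEdge n)) = {e | c e ≠ 0} := by rw [hS]; ext; simp
  have hcomp : IsCompatible (S : Set (SignedEdge n)) := hSc ▸ hc.compat
  have hspan := hgen S <| by
    rw [← hc.sum_eq]
    refine Submodule.sum_mem _ fun e _ => ?_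
    by_cases he : c e = 0
    · simp [he]
    · exact Submodule.smul_mem _ _ (Submodule.subset_span ⟨e, by rw [hSc]; exact he, rfl⟩)
  refine Set.mem_iUnion.2 ⟨⟨graphOf S, hcomp.isWellStructured hn hspan⟩, ?_⟩
  refine (SignedGraph.mem_rootPolytope_iff hcomp).2 ⟨c, hc, fun e he => ?_, ?_⟩
  · exact Finset.mem_coe.1 (hSc ▸ he : e ∈ (S : Set (SignedEdge n)))
  · linarith [hc.two_mul_sum]

end AltWS

theorem isCentralTriangulation (hn : 1 ≤ n) :
    IsCentralTriangulation (fun T : AltWS n => T.1.rootPolytope) (fullRootPolytope n) where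
  finite := inferInstance
  isSimplex T := by
    classical
    refine ⟨_, T.isSimplexOn.1, T.isSimplexOn.2, Finset.mem_insert_self _ _, ?_⟩
    rw [Finset.coe_insert, Finset.coe_image, positiveRoots_eq_range]
    exact Set.insert_subset_insert (Set.image_subset_range _ _)
  disjoint_interior _ _ h := AltWS.disjoint_interior h
  inter_eq T U _ _ hV hW := AltWS.inter_eq T U hV hW
  iUnion_eq := AltWS.iUnion_eq hn

end Polytopes

/-! ### The volume -/

section Volume

variable {n : ℕ}

/-- The convolution square of the central binomial coefficients is `4 ^ n`. -/
lemma sum_centralBinom_mul_centralBinom (n : ℕ) :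
    ∑ p ∈ Finset.HasAntidiagonal.antidiagonal n, (p.1.centralBinom : ℝ) * p.2.centralBinom = 4 ^ n := by
  -- `s n = ∑ p.1 * c p.1 * c p.2` is `n / 2` times the sum in question by symmetry, and it
  -- satisfies a recursion coming from that of the central binomial coefficients.
  have hsym : ∀ n : ℕ, 2 * ∑ p ∈ Finset.HasAntidiagonal.antidiagonal n,
      (p.1 : ℝ) * ((p.1.centralBinom : ℝ) * p.2.centralBinom) =
      n * ∑ p ∈ Finset.HasAntidiagonal.antidiagonal n, (p.1.centralBinom : ℝ) * p.2.centralBinom := by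
    intro n
    have h := Finset.Nat.sum_antidiagonal_swap (n := n)
      (f := fun p : ℕ × ℕ => (p.1 : ℝ) * ((p.1.centralBinom : ℝ) * p.2.centralBinom))
    rw [two_mul]
    nth_rewrite 1 [← h]
    rw [← Finset.sum_add_distrib, Finset.mul_sum]
    refine Finset.sum_congr rfl fun p hp => ?_
    rw [← Finset.HasAntidiagonal.mem_antidiagonal.1 hp]
    push_cast [Prod.fst_swap, Prod.snd_swap]
    ring
  have hrec : ∀ n : ℕ, ∑ p ∈ Finset.HasAntidiagonal.antidiagonal (n + 1),
      (p.1 : ℝ) * ((p.1.centralBinom : ℝ) * p.2.centralBinom) =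
      4 * ∑ p ∈ Finset.HasAntidiagonal.antidiagonal n,
        (p.1 : ℝ) * ((p.1.centralBinom : ℝ) * p.2.centralBinom) +
      2 * ∑ p ∈ Finset.HasAntidiagonal.antidiagonal n, (p.1.centralBinom : ℝ) * p.2.centralBinom := by
    intro n
    rw [Finset.Nat.sum_antidiagonal_succ, Finset.mul_sum, Finset.mul_sum,
      ← Finset.sum_add_distrib]
    simp only [Nat.cast_zero, zero_mul, zero_add]
    refine Finset.sum_congr rfl fun p _ => ?_
    have h : ((p.1 + 1 : ℕ) : ℝ) * (p.1 + 1).centralBinom =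
        2 * (2 * p.1 + 1) * p.1.centralBinom := by
      exact_mod_cast Nat.succ_mul_centralBinom_succ p.1
    rw [← mul_assoc, h]
    ring
  induction n with
  | zero => simp
  | succ n ih =>
    have h1 := hsym n
    have h2 := hsym (n + 1)
    rw [hrec n] at h2
    rw [ih] at h1 h2
    have h3 : ((n : ℝ) + 1) * ∑ p ∈ Finset.HasAntidiagonal.antidiagonal (n + 1),
        (p.1.centralBinom : ℝ) * p.2.centralBinom = (n + 1) * 4 ^ (n + 1) := by
      push_cast at h2
      rw [← h2, pow_succ]
      linarith
    exact mul_left_cancel₀ (by positivity) h3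

/-- A nonnegative sequence is determined by its convolution square. -/
lemma eq_centralBinom_div_of_sum {r : ℕ → ℝ} (hr : ∀ n, 0 ≤ r n)
    (h : ∀ n, ∑ p ∈ Finset.HasAntidiagonal.antidiagonal n, r p.1 * r p.2 = 2 ^ n) (n : ℕ) :
    r n = n.centralBinom / 2 ^ n := by
  obtain ⟨q, hq⟩ : ∃ q : ℕ → ℝ, q = fun n => (n.centralBinom : ℝ) / 2 ^ n := ⟨_, rfl⟩
  have hqs : ∀ n, ∑ p ∈ Finset.HasAntidiagonal.antidiagonal n, q p.1 * q p.2 = 2 ^ n := by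
    intro n
    have h1 : ∀ p ∈ Finset.HasAntidiagonal.antidiagonal n, q p.1 * q p.2 =
        (p.1.centralBinom : ℝ) * p.2.centralBinom / 2 ^ n := by
      intro p hp
      rw [hq, ← Finset.HasAntidiagonal.mem_antidiagonal.1 hp, pow_add]
      exact div_mul_div_comm _ _ _ _
    rw [Finset.sum_congr rfl h1, ← Finset.sum_div, sum_centralBinom_mul_centralBinom,
      div_eq_iff (by positivity), ← mul_pow]
    norm_num
  have hsq : PowerSeries.mk r * PowerSeries.mk r = PowerSeries.mk q * PowerSeries.mk q := by
    ext m
    rw [PowerSeries.coeff_mul, PowerSeries.coeff_mul]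
    simp only [PowerSeries.coeff_mk]
    rw [h, hqs]
  rcases mul_self_eq_mul_self_iff.1 hsq with heq | heq
  · have := congrArg (PowerSeries.coeff n) heq
    simpa [hq] using this
  · have := congrArg (PowerSeries.coeff 0) heq
    simp [hq] at this
    linarith [hr 0]

/-- The density `exp (-‖x‖₁)`. -/
noncomputable def laplaceDensity (x : Fin n → ℝ) : ENNReal :=
  ENNReal.ofReal (Real.exp (-∑ v, |x v|))

lemma measurable_laplaceDensity : Measurable (laplaceDensity (n := n)) := by
  unfold laplaceDensity
  fun_prop

lemma lintegral_laplaceDensity : ∫⁻ x : Fin n → ℝ, laplaceDensity x = 2 ^ n := by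
  have hint : Integrable (fun x : ℝ => Real.exp (-|x|)) := by
    have h := (integrableOn_exp_mul_Iic (a := 1) one_pos 0)
    have h' := (integrableOn_exp_mul_Ioi (a := -1) (by norm_num) 0)
    rw [← integrableOn_univ, ← Set.Iic_union_Ioi (a := (0 : ℝ))]
    refine IntegrableOn.union (h.congr_fun (fun x hx => ?_) measurableSet_Iic)
      (h'.congr_fun (fun x hx => ?_) measurableSet_Ioi)
    · simp [abs_of_nonpos (Set.mem_Iic.1 hx)]
    · simp [abs_of_pos (Set.mem_Ioi.1 hx)]
  have hval : ∫ x : ℝ, Real.exp (-|x|) = 2 := by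
    rw [integral_comp_abs (f := fun x => Real.exp (-x)), integral_exp_neg_Ioi_zero, mul_one]
  have hprod : ∀ x : Fin n → ℝ, Real.exp (-∑ v, |x v|) = ∏ v, Real.exp (-|x v|) := by
    intro x
    rw [← Real.exp_sum, Finset.sum_neg_distrib]
  simp only [laplaceDensity, hprod]
  rw [volume_pi, ← ofReal_integral_eq_lintegral_ofReal
      (Integrable.fintype_prod (f := fun (_ : Fin n) (x : ℝ) => Real.exp (-|x|)) fun _ => hint)
      (Filter.Eventually.of_forall fun x => Finset.prod_nonneg fun _ _ => (Real.exp_pos _).le), ← volume_pi,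
    integral_fintype_prod_volume_eq_pow (fun x : ℝ => Real.exp (-|x|)), hval]
  simp

lemma measurable_prefixSum (k : ℕ) : Measurable fun x : Fin n → ℝ => prefixSum x k := by
  unfold prefixSum
  fun_prop

lemma measurableSet_prefixCone : MeasurableSet (prefixCone n) := by
  have : prefixCone n = ⋂ k, {x | 0 ≤ prefixSum x k} := by ext; simp [prefixCone]
  rw [this]
  exact MeasurableSet.iInter fun k => measurableSet_le measurable_const (measurable_prefixSum k)

/-- The vectors whose sequence of prefix sums attains its minimum at the place `k`. -/
def minPrefixAt (n k : ℕ) : Set (Fin n → ℝ) := {x | ∀ j, prefixSum x k ≤ prefixSum x j}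

lemma measurableSet_minPrefixAt (k : ℕ) : MeasurableSet (minPrefixAt n k) := by
  have : minPrefixAt n k = ⋂ j, {x | prefixSum x k ≤ prefixSum x j} := by
    ext; simp [minPrefixAt]
  rw [this]
  exact MeasurableSet.iInter fun j =>
    measurableSet_le (measurable_prefixSum k) (measurable_prefixSum j)

lemma prefixSum_of_le (x : Fin n → ℝ) {k : ℕ} (h : n ≤ k) : prefixSum x k = ∑ i, x i := by
  rw [prefixSum, Finset.filter_true_of_mem fun i _ => i.2.trans_le h]

lemma prefixSum_append {a b : ℕ} (u : Fin a → ℝ) (w : Fin b → ℝ) (k : ℕ) :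
    prefixSum (Fin.append u w) k = prefixSum u k + prefixSum w (k - a) := by
  have h : ∀ i : Fin b, a + (i : ℕ) < k ↔ (i : ℕ) < k - a := fun i => by omega
  simp only [prefixSum_eq, Fin.sum_univ_add, Fin.append_left, Fin.append_right, Fin.val_castAdd,
    Fin.val_natAdd, h]

/-- Reversing and negating the steps turns prefix sums into differences of prefix sums. -/
lemma prefixSum_neg_rev (u : Fin n → ℝ) (k : ℕ) :
    prefixSum (fun i => -u i.rev) k = prefixSum u (n - k) - prefixSum u n := by
  rw [prefixSum_of_le u le_rfl, prefixSum_eq, prefixSum_eq,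
    ← Equiv.sum_comp Fin.revPerm, ← Finset.sum_sub_distrib]
  refine Finset.sum_congr rfl fun i _ => ?_
  simp only [Fin.revPerm_apply, Fin.rev_rev, Fin.val_rev]
  by_cases h : (i : ℕ) < n - k
  · rw [if_neg (by omega), if_pos h]; ring
  · rw [if_pos (by omega), if_neg h]; ring

lemma append_mem_minPrefixAt_iff {a b : ℕ} {u : Fin a → ℝ} {w : Fin b → ℝ} :
    Fin.append u w ∈ minPrefixAt (a + b) a ↔
      (fun i => -u i.rev) ∈ prefixCone a ∧ w ∈ prefixCone b := by
  have h0 : prefixSum w 0 = 0 := by simp [prefixSum]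
  simp only [minPrefixAt, prefixCone, Set.mem_ofPred_eq, prefixSum_append, prefixSum_neg_rev,
    tsub_self, h0, add_zero, sub_nonneg]
  constructor
  · intro h
    refine ⟨fun k => ?_, fun k => ?_⟩
    · have := h (a - k)
      rwa [Nat.sub_eq_zero_of_le (Nat.sub_le a k), h0, add_zero] at this
    · have := h (a + k)
      rw [prefixSum_of_le u (Nat.le_add_right a k), prefixSum_of_le u le_rfl,
        Nat.add_sub_cancel_left] at this
      linarith
  · rintro ⟨h1, h2⟩ j
    rcases le_total j a with h | h
    · have := h1 (a - j)
      rw [Nat.sub_sub_self h] at this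
      linarith [h2 (j - a)]
    · rw [prefixSum_of_le u h, prefixSum_of_le u le_rfl]
      linarith [h2 (j - a)]

lemma measurePreserving_append (a b : ℕ) :
    MeasurePreserving (fun p : (Fin a → ℝ) × (Fin b → ℝ) => Fin.append p.1 p.2) := by
  have h := (volume_measurePreserving_piCongrLeft (fun _ : Fin (a + b) => ℝ)
    (finSumFinEquiv (m := a) (n := b))).comp
    (volume_measurePreserving_sumPiEquivProdPi_symm (fun _ : Fin a ⊕ Fin b => ℝ))
  suffices hf : (fun p : (Fin a → ℝ) × (Fin b → ℝ) => Fin.append p.1 p.2) = _ from hf ▸ h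
  funext p i
  refine Fin.addCases (fun i => ?_) (fun i => ?_) i
  · have := Equiv.piCongrLeft_apply_apply (fun _ : Fin (a + b) => ℝ) finSumFinEquiv
      ((MeasurableEquiv.sumPiEquivProdPi (fun _ : Fin a ⊕ Fin b => ℝ)).symm p) (Sum.inl i)
    rw [finSumFinEquiv_apply_left] at this
    rw [Fin.append_left]
    exact this.symm
  · have := Equiv.piCongrLeft_apply_apply (fun _ : Fin (a + b) => ℝ) finSumFinEquiv
      ((MeasurableEquiv.sumPiEquivProdPi (fun _ : Fin a ⊕ Fin b => ℝ)).symm p) (Sum.inr i)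
    rw [finSumFinEquiv_apply_right] at this
    rw [Fin.append_right]
    exact this.symm

lemma measurePreserving_neg_rev (a : ℕ) :
    MeasurePreserving (fun (u : Fin a → ℝ) (i : Fin a) => -u i.rev) := by
  have h := (Measure.measurePreserving_neg (volume : Measure (Fin a → ℝ))).comp
    (volume_measurePreserving_piCongrLeft (fun _ : Fin a => ℝ) Fin.revPerm)
  suffices hf : (fun (u : Fin a → ℝ) (i : Fin a) => -u i.rev) = _ from hf ▸ h
  funext u i
  have := Equiv.piCongrLeft_apply_apply (fun _ : Fin a => ℝ) Fin.revPerm u i.rev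
  simp only [Fin.revPerm_apply, Fin.rev_rev] at this
  rw [Function.comp_apply, Pi.neg_apply, MeasurableEquiv.coe_piCongrLeft, this]

/-- The mass of the cone of vectors with nonnegative prefix sums. -/
noncomputable def coneMass (n : ℕ) : ENNReal := ∫⁻ x in prefixCone n, laplaceDensity x

lemma lintegral_minPrefixAt (a b : ℕ) :
    ∫⁻ x in minPrefixAt (a + b) a, laplaceDensity x = coneMass a * coneMass b := by
  have hrev : ∫⁻ u in (fun (u : Fin a → ℝ) (i : Fin a) => -u i.rev) ⁻¹' prefixCone a,
      laplaceDensity u = coneMass a := by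
    rw [coneMass, ← (measurePreserving_neg_rev a).setLIntegral_comp_preimage
      measurableSet_prefixCone measurable_laplaceDensity]
    refine lintegral_congr fun u => ?_
    simp only [laplaceDensity, abs_neg]
    rw [← Equiv.sum_comp Fin.revPerm (fun i => |u i|)]
    rfl
  rw [← (measurePreserving_append a b).setLIntegral_comp_preimage
    (measurableSet_minPrefixAt a) measurable_laplaceDensity]
  have hpre : (fun p : (Fin a → ℝ) × (Fin b → ℝ) => Fin.append p.1 p.2) ⁻¹'
      minPrefixAt (a + b) a =
      ((fun (u : Fin a → ℝ) (i : Fin a) => -u i.rev) ⁻¹' prefixCone a) ×ˢ prefixCone b := by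
    ext p
    exact append_mem_minPrefixAt_iff
  have hfun : ∀ p : (Fin a → ℝ) × (Fin b → ℝ), laplaceDensity (Fin.append p.1 p.2) =
      laplaceDensity p.1 * laplaceDensity p.2 := by
    intro p
    rw [laplaceDensity, laplaceDensity, laplaceDensity, ← ENNReal.ofReal_mul (Real.exp_pos _).le,
      ← Real.exp_add, Fin.sum_univ_add]
    simp only [Fin.append_left, Fin.append_right, neg_add]
  simp only [hfun]
  rw [hpre, Measure.volume_eq_prod, ← Measure.prod_restrict,
    lintegral_prod_mul measurable_laplaceDensity.aemeasurable
      measurable_laplaceDensity.aemeasurable, hrev]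
  rfl

lemma aedisjoint_minPrefixAt {j k : ℕ} (hjk : j < k) (hk : k ≤ n) :
    AEDisjoint volume (minPrefixAt n j) (minPrefixAt n k) := by
  let φ : (Fin n → ℝ) →ₗ[ℝ] ℝ :=
    { toFun := fun x => prefixSum x k - prefixSum x j
      map_add' := fun x y => by simp only [prefixSum_add]; ring
      map_smul' := fun a x => by simp only [prefixSum_smul, RingHom.id_apply, smul_eq_mul]; ring }
  have hφ : LinearMap.ker φ ≠ ⊤ := by
    intro h
    have h1 : (Pi.single ⟨j, hjk.trans_le hk⟩ 1 : Fin n → ℝ) ∈ LinearMap.ker φ :=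
      h ▸ Submodule.mem_top
    have h2 : prefixSum (Pi.single (⟨j, hjk.trans_le hk⟩ : Fin n) 1) k -
      prefixSum (Pi.single (⟨j, hjk.trans_le hk⟩ : Fin n) 1) j = 0 := h1
    simp [prefixSum_eq, Pi.single_apply, hjk] at h2
  refine measure_mono_null (fun x hx => ?_) (Measure.addHaar_submodule volume _ hφ)
  exact sub_eq_zero.2 (le_antisymm (hx.2 j) (hx.1 k))

/-- The Sparre Andersen recursion: the minimum of the prefix sums is attained somewhere, and almost
everywhere at one place only; it cuts the vector into two parts that lie in cones of the same
kind. -/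
lemma sum_coneMass_mul_coneMass (n : ℕ) :
    ∑ p ∈ Finset.HasAntidiagonal.antidiagonal n, coneMass p.1 * coneMass p.2 = 2 ^ n := by
  have h1 : ∀ p ∈ Finset.HasAntidiagonal.antidiagonal n, coneMass p.1 * coneMass p.2 =
      ∫⁻ x in minPrefixAt n p.1, laplaceDensity x := by
    intro p hp
    rw [← Finset.HasAntidiagonal.mem_antidiagonal.1 hp, lintegral_minPrefixAt]
  rw [Finset.sum_congr rfl h1,
    Finset.Nat.sum_antidiagonal_eq_sum_range_succ_mk,
    ← lintegral_biUnion_finset₀ (t := minPrefixAt n)]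
  · suffices hU : ⋃ k ∈ Finset.range n.succ, minPrefixAt n k = Set.univ by
      rw [hU, setLIntegral_univ, lintegral_laplaceDensity]
    refine Set.eq_univ_of_forall fun x => ?_
    obtain ⟨k, hk, hmin⟩ := Finset.exists_min_image (Finset.range (n + 1)) (prefixSum x)
      ⟨0, by simp⟩
    refine Set.mem_biUnion hk fun j => ?_
    rcases le_or_gt j n with h | h
    · exact hmin j (by simpa [Nat.lt_succ_iff] using h)
    · rw [prefixSum_of_le x h.le, ← prefixSum_of_le x le_rfl]
      exact hmin n (by simp)
  · intro j hj k hk hjk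
    rw [Finset.mem_coe, Finset.mem_range] at hj hk
    rcases lt_or_gt_of_ne hjk with h | h
    · exact aedisjoint_minPrefixAt h (Nat.lt_succ_iff.1 hk)
    · exact (aedisjoint_minPrefixAt h (Nat.lt_succ_iff.1 hj)).symm
  · exact fun k _ => (measurableSet_minPrefixAt k).nullMeasurableSet

lemma coneMass_ne_top (n : ℕ) : coneMass n ≠ ⊤ := by
  refine ne_top_of_le_ne_top ?_ (setLIntegral_le_lintegral _ _)
  rw [lintegral_laplaceDensity]
  exact ENNReal.pow_ne_top (by norm_num)

lemma coneMass_eq (n : ℕ) : coneMass n = ENNReal.ofReal (n.centralBinom / 2 ^ n) := by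
  rw [← eq_centralBinom_div_of_sum (r := fun n => (coneMass n).toReal)
    (fun _ => ENNReal.toReal_nonneg) (fun n => ?_) n, ENNReal.ofReal_toReal (coneMass_ne_top n)]
  have h := congrArg ENNReal.toReal (sum_coneMass_mul_coneMass n)
  rw [ENNReal.toReal_sum fun p _ => ENNReal.mul_ne_top (coneMass_ne_top _) (coneMass_ne_top _)] at h
  simpa using h

/-- The root polytope scaled by `t / 2`. -/
lemma volume_prefixCone_inter {t : ℝ} (ht : 0 < t) :
    volume {x : Fin n → ℝ | x ∈ prefixCone n ∧ ∑ v, |x v| ≤ t} =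
      ENNReal.ofReal ((t / 2) ^ n) * volume (fullRootPolytope n) := by
  have hset : {x : Fin n → ℝ | x ∈ prefixCone n ∧ ∑ v, |x v| ≤ t} =
      (fun x => (2 / t) • x) ⁻¹' fullRootPolytope n := by
    ext x
    have h2 : (0 : ℝ) < 2 / t := by positivity
    simp only [Set.mem_ofPred_eq, Set.mem_preimage, mem_fullRootPolytope_iff, prefixCone,
      prefixSum_smul, Pi.smul_apply, smul_eq_mul, abs_mul, abs_of_pos h2, ← Finset.mul_sum]
    refine and_congr (forall_congr' fun k => ?_) ?_
    · rw [mul_nonneg_iff_of_pos_left h2]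
    · rw [div_mul_eq_mul_div, div_le_iff₀ ht]
      constructor <;> intro h <;> linarith
  rw [hset, Measure.addHaar_preimage_smul volume (by positivity)]
  congr 2
  rw [Module.finrank_pi, Fintype.card_fin, abs_of_pos (by positivity), ← inv_pow, inv_div]

lemma ofReal_exp_neg_eq_lintegral {r : ℝ} (hr : 0 ≤ r) : ENNReal.ofReal (Real.exp (-r)) =
    ∫⁻ t in Set.Ioi 0, (if r ≤ t then 1 else 0) * ENNReal.ofReal (Real.exp (-t)) := by
  have h1 : ∀ t : ℝ, (if r ≤ t then 1 else 0) * ENNReal.ofReal (Real.exp (-t)) =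
      (Set.Ici r).indicator (fun t => ENNReal.ofReal (Real.exp (-t))) t := by
    intro t
    by_cases h : r ≤ t <;> simp [h]
  simp only [h1]
  rw [lintegral_indicator measurableSet_Ici, Measure.restrict_restrict measurableSet_Ici,
    ← integral_exp_neg_Ioi, ofReal_integral_eq_lintegral_ofReal]
  · refine setLIntegral_congr ?_
    rw [Set.inter_comm]
    rcases hr.eq_or_lt with rfl | h
    · rw [Set.inter_eq_left.2 Set.Ioi_subset_Ici_self]
      exact Filter.EventuallyEq.rfl
    · have hsub : Set.Ici r ⊆ Set.Ioi 0 := fun t ht => h.trans_le (Set.mem_Ici.1 ht)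
      rw [Set.inter_eq_right.2 hsub]
      exact Ioi_ae_eq_Ici
  · have := integrableOn_exp_mul_Ioi (a := -1) (by norm_num) r
    simpa [IntegrableOn] using this
  · exact Filter.Eventually.of_forall fun _ => (Real.exp_pos _).le

/-- Integrating the density over the cone by layers relates it to the volume of the polytope. -/
lemma coneMass_eq_mul_volume (n : ℕ) :
    coneMass n = ENNReal.ofReal (n.factorial / 2 ^ n) * volume (fullRootPolytope n) := by
  have hmeas : Measurable fun p : (Fin n → ℝ) × ℝ =>
      (if ∑ v, |p.1 v| ≤ p.2 then (1 : ENNReal) else 0) * ENNReal.ofReal (Real.exp (-p.2)) := by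
    refine Measurable.mul (Measurable.ite (measurableSet_le ?_ ?_) ?_ ?_) ?_ <;> fun_prop
  have h1 : coneMass n = ∫⁻ x in prefixCone n, ∫⁻ t in Set.Ioi (0 : ℝ),
      (if ∑ v, |x v| ≤ t then 1 else 0) * ENNReal.ofReal (Real.exp (-t)) := by
    refine lintegral_congr fun x => ?_
    exact ofReal_exp_neg_eq_lintegral (Finset.sum_nonneg fun v _ => abs_nonneg _)
  rw [h1, lintegral_lintegral_swap hmeas.aemeasurable]
  have h2 : ∀ t ∈ Set.Ioi (0 : ℝ), ∫⁻ x in prefixCone n,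
      (if ∑ v, |x v| ≤ t then 1 else 0) * ENNReal.ofReal (Real.exp (-t)) =
      ENNReal.ofReal (Real.exp (-t) * t ^ n) *
        (ENNReal.ofReal (1 / 2 ^ n) * volume (fullRootPolytope n)) := by
    intro t ht
    rw [Set.mem_Ioi] at ht
    have hms : MeasurableSet {x : Fin n → ℝ | ∑ v, |x v| ≤ t} :=
      measurableSet_le (by fun_prop) measurable_const
    have h3 : ∀ x : Fin n → ℝ, (if ∑ v, |x v| ≤ t then (1 : ENNReal) else 0) =
        {x : Fin n → ℝ | ∑ v, |x v| ≤ t}.indicator 1 x := fun x => by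
      simp [Set.indicator_apply]
    rw [lintegral_mul_const _ (Measurable.ite hms measurable_const measurable_const)]
    simp only [h3]
    rw [lintegral_indicator_one hms, Measure.restrict_apply hms]
    have h4 : {x : Fin n → ℝ | ∑ v, |x v| ≤ t} ∩ prefixCone n =
        {x : Fin n → ℝ | x ∈ prefixCone n ∧ ∑ v, |x v| ≤ t} := by
      ext; exact and_comm
    rw [h4, volume_prefixCone_inter ht, mul_right_comm, ← mul_assoc,
      ← ENNReal.ofReal_mul (by positivity), ← ENNReal.ofReal_mul (by positivity)]
    congr 2
    rw [div_pow]
    ring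
  rw [setLIntegral_congr_fun measurableSet_Ioi h2, lintegral_mul_const _ (by fun_prop)]
  have hGamma : ∫⁻ t in Set.Ioi (0 : ℝ), ENNReal.ofReal (Real.exp (-t) * t ^ n) =
      ENNReal.ofReal n.factorial := by
    have hg := Real.Gamma_eq_integral (s := n + 1) (by positivity)
    have hi := Real.GammaIntegral_convergent (s := n + 1) (by positivity)
    simp only [add_sub_cancel_right, Real.rpow_natCast] at hg hi
    rw [← Real.Gamma_nat_eq_factorial, hg, ofReal_integral_eq_lintegral_ofReal hi]
    filter_upwards [ae_restrict_mem measurableSet_Ioi] with t ht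
    have : (0 : ℝ) < t := ht
    positivity
  rw [hGamma, ← mul_assoc, ← ENNReal.ofReal_mul (by positivity), mul_one_div]

theorem volume_fullRootPolytope (hn : 1 ≤ n) : volume (fullRootPolytope n) =
    ENNReal.ofReal (((2 * n - 1).choose n : ℝ) * (2 / (n.factorial : ℝ))) := by
  have hchoose : (n.centralBinom : ℝ) = 2 * ((2 * n - 1).choose n : ℝ) := by
    obtain ⟨m, rfl⟩ : ∃ m, n = m + 1 := ⟨n - 1, by omega⟩
    have h1 := Nat.choose_symm_half m
    have h2 : 2 * (m + 1) - 1 = 2 * m + 1 := by omega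
    rw [Nat.centralBinom_eq_two_mul_choose, h2, show 2 * (m + 1) = 2 * m + 1 + 1 by ring,
      Nat.choose_succ_succ, h1]
    push_cast
    ring
  have h := coneMass_eq_mul_volume n
  rw [coneMass_eq] at h
  have hf : (0 : ℝ) < n.factorial := by positivity
  have h2 := congrArg (fun z => ENNReal.ofReal (2 ^ n / n.factorial) * z) h
  rw [← mul_assoc, ← ENNReal.ofReal_mul (by positivity), ← ENNReal.ofReal_mul (by positivity),
    div_mul_div_cancel₀ hf.ne', div_self (by positivity), ENNReal.ofReal_one, one_mul] at h2
  rw [← h2]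
  congr 1
  rw [hchoose]
  field_simp

end Volume

theorem theorem9p5 (n : ℕ) (hn : 1 ≤ n) :
    IsCentralTriangulation
      (fun T : {T : SignedGraph n // T.IsAlternating ∧ T.IsWellStructured} => T.1.rootPolytope)
      (fullRootPolytope n) ∧
    volume (fullRootPolytope n) =
      ENNReal.ofReal (((2 * n - 1).choose n : ℝ) * (2 / (n.factorial : ℝ))) :=
  ⟨isCentralTriangulation hn, volume_fullRootPolytope hn⟩
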